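/- **Convexity Theorem for Coxeter groups.** Let $V$ be a finite-dimensional real vector space, $(\alpha_s)_{s\in S}$ a finite family of linear functionals on $V$ and $(\alpha_s^\vee)_{s\in S}$ a family of elements of $V$ with $\alpha_s(\alpha_s^\vee)=2$ for all $s \in S$. Put $r_s(v)=v-\alpha_s(v)\alpha_s^\vee$, let $\mathcal W=\langle r_s : s\in S\rangle\subseteq \mathrm{GL}(V)$, and let $K=\{v\in V : \alpha_s(v)\ge 0 \text{ for all } s\in S\}$. For a subset $X$ of a real vector space, $\mathrm{cone}(X)$ denotes the convex cone, containing $0$, generated by $X$; $X^0$ is the interior and $\overline X$ the closure. Assume that these data form a linear Coxeter system, i.e. 1. $K^0\neq\emptyset$; 2. $\alpha_s\notin \mathrm{cone}\{\alpha_t : t\ne s\}$ for every $s\in S$; 3. $wK^0\cap K^0=\emptyset$ for every $w\in\mathcal W\setminus\{e\}$. Let $\mathcal T=\mathcal W K$ be the Tits cone, $C_S=\mathrm{cone}\{\alpha_s^\vee : s\in S\}$, and for $v\in V$ let $C_v=\mathrm{cone}\{\alpha^\vee : \alpha\in\Delta,\ \alpha(v)>0\}$, where $\Delta=\mathcal W\{\alpha_s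 : s\in S\}$ is the set of roots (with $w\alpha=\alpha\circ w^{-1}$) and the coroot of $\alpha=w\alpha_s$ is $\alpha^\vee=w\alpha_s^\vee$. Let $\overline{\mathrm{co}}(v)$ be the closed convex hull of the orbit $\mathcal W v$. Then for every $v\in\mathcal T$ $$\overline{\mathrm{co}}(v)\cap\mathcal T=\mathcal T\cap\bigcap_{w\in\mathcal W}w\bigl(v-\overline{C_v}\bigr).$$ If $v\in\mathcal T^0$, then $C_v$ is closed, $\overline{\mathrm{co}}(v)\subseteq\mathcal T^0$, and $$\overline{\mathrm{co}}(v)=\mathcal T\cap\bigcap_{w\in\mathcal W}w(v-C_v)=\mathcal T\cap\bigcap_{w\in\mathcal W}w(v'-C_S)\qquad\text{for every } v'\in\mathcal W v\cap K;$$ in particular, if moreover $v\in K$, then $\overline{\mathrm{co}}(v)=\mathcal T\cap\bigcap_{w\in\mathcal W}w(v-C_S)$. -/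

import Mathlib

/-- A reflection data on the real vector space `V`: functionals `α_s` and vectors `α_s^∨`
(indexed by `s : S`) with `α_s (α_s^∨) = 2`. -/
structure ReflectionData (S V : Type*) [AddCommGroup V] [Module ℝ V] where
  /-- the functionals `α_s` -/
  root : S → Module.Dual ℝ V
  /-- the vectors `α_s^∨` -/
  coroot : S → V
  root_coroot_two : ∀ s, root s (coroot s) = 2

namespace ReflectionData

variable {S V : Type*} [AddCommGroup V] [Module ℝ V] (D : ReflectionData S V)

/-- The reflection `r_s v = v - α_s(v) α_s^∨`. -/
noncomputable def reflection (s : S) : V ≃ₗ[ℝ] V :=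
  Module.reflection (D.root_coroot_two s)

theorem reflection_apply (s : S) (v : V) :
    D.reflection s v = v - D.root s v • D.coroot s :=
  Module.reflection_apply v (D.root_coroot_two s)

/-- The subgroup `𝒲` of `GL(V)` generated by the reflections `r_s`. -/
def weylGroup : Subgroup (V ≃ₗ[ℝ] V) :=
  Subgroup.closure (Set.range D.reflection)

/-- The fundamental chamber `K`. -/
def chamber : Set V := {v | ∀ s, 0 ≤ D.root s v}

/-- The orbit `𝒲 v`. -/
def orbit (v : V) : Set V := {x | ∃ w ∈ D.weylGroup, x = w v}

/-- The Tits cone `𝒯 = 𝒲 K`. -/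
def titsCone : Set V := {x | ∃ w ∈ D.weylGroup, ∃ k ∈ D.chamber, x = w k}

/-- `α` is a root and `a` is its coroot: for some `w ∈ 𝒲` and `s`, `α = w α_s` and
`a = w α_s^∨`. Here `w` acts on functionals by `w α = α ∘ w⁻¹`. -/
def IsRootCorootPair (α : Module.Dual ℝ V) (a : V) : Prop :=
  ∃ w ∈ D.weylGroup, ∃ s,
    α = D.root s ∘ₗ ((w⁻¹ : V ≃ₗ[ℝ] V) : V →ₗ[ℝ] V) ∧ a = w (D.coroot s)

/-- The cone `C_S` generated by the `α_s^∨` (it contains `0`). -/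
def simpleCone : PointedCone ℝ V := PointedCone.hull ℝ (Set.range D.coroot)

/-- The cone `C_v` generated by the coroots `α^∨` of the roots `α` with `α(v) > 0`
(it contains `0`). -/
def coneAt (v : V) : PointedCone ℝ V :=
  PointedCone.hull ℝ {a | ∃ α, D.IsRootCorootPair α a ∧ 0 < α v}

/-- The conditions that make a reflection data with finite index set `S` a linear Coxeter
system. -/
structure IsLinearCoxeterSystem [TopologicalSpace V] : Prop where
  finite_index : Finite S
  interior_nonempty : (interior D.chamber).Nonempty
  root_notMem : ∀ s, D.root s ∉ PointedCone.hull ℝ (D.root '' {t | t ≠ s})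
  disjoint_chambers : ∀ w ∈ D.weylGroup, w ≠ 1 →
    (w '' interior D.chamber) ∩ interior D.chamber = ∅

end ReflectionData

/-!
# Convex hulls of orbits of linear Coxeter groups

Write `K` for the chamber, `T` for the Tits cone and `A` for the closed convex hull of the orbit
of `v ∈ T`.

*Combinatorics.* Disjointness of the open chambers says that no wall `ker α_s` meets an open
chamber, so every root has a sign on every chamber. Irredundancy of the family of roots provides
points in the relative interior of each wall of `K` (Farkas' lemma), and the two facts give the
exchange condition (`length_reflection_mul_lt`): if `α_s` is negative somewhere on `w K`, then
`r_s w` is shorter than `w`. Induction on the length shows that `T` is convex, and that `x ∈ 𝒲 v`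
is reached from `v ∈ K` by reflections which each subtract a nonnegative multiple of a coroot.
This gives `𝒲 v ⊆ v - C_v` (`sub_mem_coneAt`), hence the inclusion of `A` in the intersection.

*The converse inclusion* is a separation argument (`mem_of_forall_sub_mem`). Let `x ∈ T` be a
point of the intersection outside `A`, and suppose that `A` meets the interior of `T`. On the
segment from `x` to a point of `A` in the interior of `T`, just before the segment enters `A`,
there are points strictly separated from `A` by a functional `f` whose maximum over `A` is
attained at some `p`, the nearest point of `A`, that is still interior to `T`. After moving `p`
into `K`, its stabilizer is finite (`exists_length_le_of_stabilizer`), so `f` may be replaced by a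
translate under the stabilizer that is nonnegative on all simple coroots: for a root positive at
`p` because `f` is maximal at `p`, for a root vanishing at `p` by maximality in the stabilizer
orbit. Such an `f` cannot separate a point of `v - closure C_v` from `v`. In general `A` need not
meet the interior of `T`; the argument is therefore carried out relative to the span `U` of the
orbit, on which stabilizers still act through finite groups, where `A` does meet the relative
interior (`exists_mem_convexHull_nhdsWithin`), with the simple roots that do not vanish on `U`.

*Orbits in the interior of `T`.* Here `C_v` is closed because it is generated by the translates of
finitely many coroots under a finite stabilizer. That `A` stays inside the interior follows from
an invariant on the cone of functionals nonnegative on `T`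
(`closedConvexHull_orbit_subset_interior`): the Weyl group acts on the span of this cone with
determinant `±1`, and the sum of a family in this cone of determinant `±1` is bounded away from
`0` on the orbit of an interior point, while at a point outside the interior such a sum can be
made arbitrarily small or negative.
-/

open Set Filter Topology

set_option linter.unusedSectionVars false

/-! ### Finitely generated cones and separation -/

section Cones

variable {V : Type*} [AddCommGroup V] [Module ℝ V]

theorem mem_hull_finset {s : Finset V} {x : V} :
    x ∈ PointedCone.hull ℝ (s : Set V) ↔
      ∃ c : V → ℝ, (∀ i ∈ s, 0 ≤ c i) ∧ ∑ i ∈ s, c i • i = x := by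
  constructor
  · intro h
    obtain ⟨f, -, hf⟩ := Submodule.mem_span_finset.1 h
    exact ⟨fun i => f i, fun i _ => (f i).2, hf⟩
  · rintro ⟨c, hc, rfl⟩
    exact Submodule.sum_mem _ fun i hi =>
      PointedCone.smul_mem _ (hc i hi) (PointedCone.subset_hull hi)

/-- The reduction step of the conical Carathéodory theorem: an element of the cone over a linearly
dependent finite set lies in the cone over a smaller one. -/
theorem exists_mem_hull_erase [DecidableEq V] {s : Finset V}
    (hs : ¬ LinearIndependent ℝ (fun i : s => (i : V))) {x : V}
    (hx : x ∈ PointedCone.hull ℝ (s : Set V)) :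
    ∃ i ∈ s, x ∈ PointedCone.hull ℝ ((s.erase i : Finset V) : Set V) := by
  obtain ⟨c, hc, rfl⟩ := mem_hull_finset.1 hx
  obtain ⟨g, hg, i₀, hi₀, hpos⟩ : ∃ g : V → ℝ, ∑ i ∈ s, g i • i = 0 ∧ ∃ i ∈ s, 0 < g i := by
    have h : ∃ g : V → ℝ, ∑ i ∈ s, g i • i = 0 ∧ ∃ i ∈ s, g i ≠ 0 := by
      by_contra! hcon
      exact hs (linearIndepOn_finset_iff (R := ℝ) (s := s) (v := (id : V → V)) |>.2 hcon)
    obtain ⟨g, hg, i, hi, hne⟩ := h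
    rcases lt_or_gt_of_ne hne with h | h
    · exact ⟨fun j => - g j, by simp [hg], i, hi, by linarith⟩
    · exact ⟨g, hg, i, hi, h⟩
  obtain ⟨i, hi, hmin⟩ := (s.filter fun i => 0 < g i).exists_min_image (fun i => c i / g i)
    ⟨i₀, by simp [hi₀, hpos]⟩
  rw [Finset.mem_filter] at hi
  refine ⟨i, hi.1, mem_hull_finset.2 ⟨fun j => c j - c i / g i * g j, ?_, ?_⟩⟩
  · intro j hj
    have hjs := Finset.mem_of_mem_erase hj
    have hq : 0 ≤ c i / g i := div_nonneg (hc i hi.1) hi.2.le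
    rcases lt_or_ge 0 (g j) with h | h
    · have := hmin j (by simp [hjs, h])
      rw [le_div_iff₀ h] at this
      linarith
    · nlinarith [hc j hjs, mul_nonneg hq (neg_nonneg.2 h)]
  · have h0 : (fun j => (c j - c i / g i * g j) • j) i = 0 := by
      beta_reduce
      rw [div_mul_cancel₀ _ hi.2.ne', sub_self, zero_smul]
    refine (Finset.sum_erase (f := fun j => (c j - c i / g i * g j) • j) s h0).trans ?_
    simp only [sub_smul, Finset.sum_sub_distrib, mul_smul, ← Finset.smul_sum, hg, smul_zero,
      sub_zero]

variable [TopologicalSpace V] [IsTopologicalAddGroup V] [ContinuousSMul ℝ V] [T2Space V]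

theorem isClosed_hull_of_linearIndependent {s : Finset V}
    (hs : LinearIndependent ℝ (fun i : s => (i : V))) :
    IsClosed (PointedCone.hull ℝ (s : Set V) : Set V) := by
  have hcl := LinearMap.isClosedEmbedding_of_injective
    (LinearMap.ker_eq_bot.2 hs.fintypeLinearCombination_injective)
  have himg : (PointedCone.hull ℝ (s : Set V) : Set V) =
      Fintype.linearCombination ℝ (fun i : s => (i : V)) '' {c | ∀ i, 0 ≤ c i} := by
    ext x
    rw [SetLike.mem_coe, mem_hull_finset]
    constructor
    · rintro ⟨c, hc, rfl⟩
      refine ⟨fun i => c i, fun i => hc i i.2, ?_⟩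
      rw [Fintype.linearCombination_apply]
      exact Finset.sum_coe_sort s (fun i => c i • i)
    · classical
      rintro ⟨c, hc, rfl⟩
      refine ⟨fun i => if h : i ∈ s then c ⟨i, h⟩ else 0,
        fun i hi => by simpa [hi] using hc ⟨i, hi⟩, ?_⟩
      rw [Fintype.linearCombination_apply, ← Finset.sum_coe_sort s]
      exact Finset.sum_congr rfl fun i _ => by simp
  rw [himg]
  refine hcl.isClosedMap _ ?_
  simp only [ofPred_forall]
  exact isClosed_iInter fun i => isClosed_le continuous_const (continuous_apply i)

theorem isClosed_hull_finset (s : Finset V) :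
    IsClosed (PointedCone.hull ℝ (s : Set V) : Set V) := by
  classical
  induction s using Finset.strongInduction with
  | H s ih =>
    by_cases hs : LinearIndependent ℝ (fun i : s => (i : V))
    · exact isClosed_hull_of_linearIndependent hs
    · have : (PointedCone.hull ℝ (s : Set V) : Set V) =
          ⋃ i ∈ s, (PointedCone.hull ℝ ((s.erase i : Finset V) : Set V) : Set V) := by
        ext x
        simp only [mem_iUnion, SetLike.mem_coe, exists_prop]
        refine ⟨exists_mem_hull_erase hs, ?_⟩
        rintro ⟨i, -, hx⟩
        exact Submodule.span_mono (by simp) hx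
      rw [this]
      exact s.finite_toSet.isClosed_biUnion fun i hi => ih _ (Finset.erase_ssubset hi)

theorem isClosed_hull_of_finite {s : Set V} (hs : s.Finite) :
    IsClosed (PointedCone.hull ℝ s : Set V) := by
  simpa using isClosed_hull_finset hs.toFinset

/-- Farkas' lemma for functionals: one that is not in the cone generated by finitely many others is
negative at some point where those are nonnegative. -/
theorem exists_neg_of_notMem_hull {E : Type*} [AddCommGroup E] [Module ℝ E]
    [FiniteDimensional ℝ E] {s : Set (Module.Dual ℝ E)}
    (hs : s.Finite) {a : Module.Dual ℝ E} (ha : a ∉ PointedCone.hull ℝ s) :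
    ∃ x : E, a x < 0 ∧ ∀ b ∈ s, 0 ≤ b x := by
  let b := Module.finBasis ℝ E
  -- A functional is identified with its values on a basis, which gives a topology to separate in.
  let e : Module.Dual ℝ E ≃ₗ[ℝ] (Fin (Module.finrank ℝ E) → ℝ) := b.constr ℝ |>.symm
  have hcl : IsClosed (PointedCone.hull ℝ (e '' s) : Set (Fin (Module.finrank ℝ E) → ℝ)) :=
    isClosed_hull_of_finite (hs.image e)
  have hmem : e a ∉ (PointedCone.hull ℝ (e '' s) : Set (Fin (Module.finrank ℝ E) → ℝ)) := by
    intro h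
    apply ha
    have h2 : PointedCone.map e.toLinearMap (PointedCone.hull ℝ s) =
        PointedCone.hull ℝ (e '' s) := Submodule.map_span _ _
    rw [SetLike.mem_coe, ← h2] at h
    obtain ⟨y, hy, hye⟩ := h
    rwa [e.injective hye] at hy
  obtain ⟨f, u, hfa, hf⟩ := geometric_hahn_banach_point_closed
    (PointedCone.convex _) hcl hmem
  have hu : u < 0 := by simpa using hf 0 (zero_mem _)
  let φ : Module.Dual ℝ (Module.Dual ℝ E) := f.toLinearMap ∘ₗ e.toLinearMap
  obtain ⟨x, hx⟩ := (Module.evalEquiv ℝ E).surjective φ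
  have hval : ∀ c : Module.Dual ℝ E, c x = f (e c) := fun c => by
    have := congrArg (fun ψ => ψ c) hx
    exact this
  refine ⟨x, by rw [hval]; linarith, fun c hc => ?_⟩
  rw [hval]
  by_contra! hneg
  have hm : (u / f (e c)) • e c ∈
      (PointedCone.hull ℝ (e '' s) : Set (Fin (Module.finrank ℝ E) → ℝ)) :=
    PointedCone.smul_mem _ (div_nonneg_of_nonpos hu.le hneg.le)
      (PointedCone.subset_hull (mem_image_of_mem e hc))
  have := hf _ hm
  rw [map_smul, smul_eq_mul, div_mul_cancel₀ _ hneg.ne] at this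
  exact lt_irrefl _ this

/-- Near a point of a closed convex set, every point outside is strictly separated from the set by a
functional whose maximum on the set is attained close by, namely at the nearest point. -/
theorem eventually_exists_support [FiniteDimensional ℝ V] {A : Set V} (hAc : IsClosed A)
    (hAconv : Convex ℝ A) {a : V} (ha : a ∈ A) {N : Set V} (hN : N ∈ 𝓝 a) :
    ∀ᶠ z in 𝓝 a, z ∉ A →
      ∃ p ∈ A ∩ N, ∃ f : Module.Dual ℝ V, (∀ b ∈ A, f b ≤ f p) ∧ f p < f z := by
  let e := toEuclidean (E := V)
  have hN' : e.symm ⁻¹' N ∈ 𝓝 (e a) :=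
    e.symm.continuous.continuousAt.preimage_mem_nhds (by simpa using hN)
  obtain ⟨r, hr, hball⟩ := Metric.mem_nhds_iff.1 hN'
  have hev : ∀ᶠ z in 𝓝 a, dist (e z) (e a) < r / 2 :=
    e.continuous.continuousAt.eventually (Metric.ball_mem_nhds _ (half_pos hr))
  filter_upwards [hev] with z hz hzA
  have hBc : IsClosed (e '' A) := e.toHomeomorph.isClosedMap _ hAc
  have hBconv : Convex ℝ (e '' A) := by
    exact hAconv.linear_image e.toLinearEquiv.toLinearMap
  obtain ⟨q, ⟨p, hp, rfl⟩, hq⟩ := exists_norm_eq_iInf_of_complete_convex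
    ⟨e a, mem_image_of_mem e ha⟩ hBc.isComplete hBconv (e z)
  have hinner := (norm_eq_iInf_iff_real_inner_le_zero hBconv (mem_image_of_mem e hp)).1 hq
  have hle : ‖e z - e p‖ ≤ ‖e z - e a‖ := by
    rw [hq]
    exact ciInf_le ⟨0, by rintro _ ⟨y, rfl⟩; exact norm_nonneg _⟩
      (⟨e a, mem_image_of_mem e ha⟩ : (e '' A))
  have hpN : p ∈ N := by
    have : e p ∈ Metric.ball (e a) r := by
      rw [Metric.mem_ball]
      calc dist (e p) (e a) ≤ dist (e z) (e p) + dist (e z) (e a) := dist_triangle_left _ _ _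
        _ < r := by rw [dist_eq_norm (e z) (e p)]; rw [dist_eq_norm] at hz ⊢; linarith
    simpa using hball this
  have hne : e z - e p ≠ 0 := by
    rw [sub_ne_zero]
    exact fun h => hzA (e.injective h ▸ hp)
  refine ⟨p, ⟨hp, hpN⟩, (innerₛₗ ℝ (e z - e p)) ∘ₗ e.toLinearEquiv.toLinearMap, fun b hb => ?_, ?_⟩
  · have := hinner (e b) (mem_image_of_mem e hb)
    rw [inner_sub_right, sub_nonpos] at this
    exact this
  · have := real_inner_self_pos.2 hne
    rw [inner_sub_right, sub_pos] at this
    exact this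

end Cones

/-! ### Words, the exchange condition and the Tits cone -/

namespace ReflectionData

section Words

variable {S V : Type*} [AddCommGroup V] [Module ℝ V] (D : ReflectionData S V)

/-- The product of the reflections spelled out by a word in `S`. -/
noncomputable def wordProd (l : List S) : V ≃ₗ[ℝ] V := (l.map D.reflection).prod

/-- The word length of `w`; it has the junk value `0` when `w` is not in the Weyl group. -/
noncomputable def length (w : V ≃ₗ[ℝ] V) : ℕ :=
  sInf {n | ∃ l : List S, l.length = n ∧ D.wordProd l = w}

@[simp] theorem wordProd_nil : D.wordProd [] = 1 := rfl

@[simp] theorem wordProd_cons (s : S) (l : List S) :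
    D.wordProd (s :: l) = D.reflection s * D.wordProd l := by
  simp [wordProd]

theorem reflection_mul_self (s : S) : D.reflection s * D.reflection s = 1 := by
  ext v
  simp [LinearEquiv.mul_apply, reflection_apply, D.root_coroot_two]
  module

@[simp] theorem reflection_reflection (s : S) (v : V) :
    D.reflection s (D.reflection s v) = v := by
  rw [← LinearEquiv.mul_apply, reflection_mul_self, LinearEquiv.coe_one, id]

@[simp] theorem reflection_inv (s : S) : (D.reflection s)⁻¹ = D.reflection s :=
  inv_eq_of_mul_eq_one_left (D.reflection_mul_self s)

theorem root_reflection_self (s : S) (v : V) : D.root s (D.reflection s v) = - D.root s v := by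
  simp [reflection_apply, D.root_coroot_two]
  ring

theorem reflection_mem (s : S) : D.reflection s ∈ D.weylGroup :=
  Subgroup.subset_closure (mem_range_self s)

theorem wordProd_mem (l : List S) : D.wordProd l ∈ D.weylGroup := by
  induction l with
  | nil => exact one_mem _
  | cons s l ih => rw [wordProd_cons]; exact mul_mem (D.reflection_mem s) ih

theorem wordProd_append (l l' : List S) :
    D.wordProd (l ++ l') = D.wordProd l * D.wordProd l' := by
  simp [wordProd]

theorem exists_wordProd_eq {w : V ≃ₗ[ℝ] V} (hw : w ∈ D.weylGroup) :
    ∃ l, D.wordProd l = w := by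
  induction hw using Subgroup.closure_induction_left with
  | one => exact ⟨[], rfl⟩
  | mul_left x hx y hy ih =>
    obtain ⟨s, rfl⟩ := hx
    obtain ⟨l, rfl⟩ := ih
    exact ⟨s :: l, by simp⟩
  | inv_mul_cancel x hx y hy ih =>
    obtain ⟨s, rfl⟩ := hx
    obtain ⟨l, rfl⟩ := ih
    exact ⟨s :: l, by simp⟩

theorem length_wordProd_le (l : List S) : D.length (D.wordProd l) ≤ l.length :=
  Nat.sInf_le ⟨l, rfl, rfl⟩

theorem exists_reduced_word {w : V ≃ₗ[ℝ] V} (hw : w ∈ D.weylGroup) :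
    ∃ l, l.length = D.length w ∧ D.wordProd l = w := by
  obtain ⟨l, hl⟩ := D.exists_wordProd_eq hw
  exact Nat.sInf_mem (s := {n | ∃ l : List S, l.length = n ∧ D.wordProd l = w}) ⟨_, l, rfl, hl⟩

theorem length_mul_reflection_le {w : V ≃ₗ[ℝ] V} (hw : w ∈ D.weylGroup) (s : S) :
    D.length (w * D.reflection s) ≤ D.length w + 1 := by
  obtain ⟨l, hl, rfl⟩ := D.exists_reduced_word hw
  rw [← hl]
  have := D.length_wordProd_le (l ++ [s])
  simpa [wordProd_append] using this

/-- A finite set of generators has only finitely many products of bounded length. -/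
theorem finite_length_le [Finite S] (n : ℕ) :
    {w | w ∈ D.weylGroup ∧ D.length w ≤ n}.Finite := by
  refine ((List.finite_length_le S n).image D.wordProd).subset ?_
  rintro w ⟨hw, hn⟩
  obtain ⟨l, hl, rfl⟩ := D.exists_reduced_word hw
  exact ⟨l, by simpa [hl] using hn, rfl⟩

theorem inv_apply_self' (w : V ≃ₗ[ℝ] V) (x : V) : w⁻¹ (w x) = x := by
  rw [← LinearEquiv.mul_apply, inv_mul_cancel, LinearEquiv.coe_one, id]

theorem apply_inv_self' (w : V ≃ₗ[ℝ] V) (x : V) : w (w⁻¹ x) = x := by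
  rw [← LinearEquiv.mul_apply, mul_inv_cancel, LinearEquiv.coe_one, id]

theorem convex_chamber : Convex ℝ D.chamber := by
  intro x hx y hy a b ha hb _ s
  simp only [map_add, map_smul, smul_eq_mul]
  exact add_nonneg (mul_nonneg ha (hx s)) (mul_nonneg hb (hy s))

theorem smul_mem_chamber {x : V} (hx : x ∈ D.chamber) {c : ℝ} (hc : 0 ≤ c) :
    c • x ∈ D.chamber := fun s => by
  rw [map_smul]; exact mul_nonneg hc (hx s)

theorem chamber_subset_titsCone : D.chamber ⊆ D.titsCone :=
  fun k hk => ⟨1, one_mem _, k, hk, rfl⟩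

theorem apply_mem_titsCone {w : V ≃ₗ[ℝ] V} (hw : w ∈ D.weylGroup) {x : V}
    (hx : x ∈ D.titsCone) : w x ∈ D.titsCone := by
  obtain ⟨u, hu, k, hk, rfl⟩ := hx
  exact ⟨w * u, mul_mem hw hu, k, hk, rfl⟩

theorem smul_mem_titsCone {x : V} (hx : x ∈ D.titsCone) {c : ℝ} (hc : 0 ≤ c) :
    c • x ∈ D.titsCone := by
  obtain ⟨u, hu, k, hk, rfl⟩ := hx
  exact ⟨u, hu, c • k, D.smul_mem_chamber hk hc, by simp⟩

/-- A segment from `K` to a point outside leaves `K` through a wall that separates the point from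
`K`. -/
theorem exists_exit [Finite S] {x y : V} (hx : x ∈ D.chamber)
    (hy : y ∉ D.chamber) : ∃ t ∈ Icc (0 : ℝ) 1, ∃ s, D.root s y < 0 ∧
      AffineMap.lineMap x y t ∈ D.chamber ∧ D.root s (AffineMap.lineMap x y t) = 0 := by
  have := Fintype.ofFinite S
  classical
  have hne : (Finset.univ.filter fun s => D.root s y < 0).Nonempty := by
    by_contra h
    apply hy
    intro s
    by_contra! hs
    exact h ⟨s, by simp [hs]⟩
  obtain ⟨s, hs, hmin⟩ := Finset.exists_min_image _
    (fun s => D.root s x / (D.root s x - D.root s y)) hne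
  have hsy : D.root s y < 0 := by simpa using hs
  have hsx := hx s
  have hden : 0 < D.root s x - D.root s y := by linarith
  have ht0 : 0 ≤ D.root s x / (D.root s x - D.root s y) := div_nonneg hsx hden.le
  have ht1 : D.root s x / (D.root s x - D.root s y) ≤ 1 := by
    rw [div_le_one hden]; linarith
  refine ⟨_, ⟨ht0, ht1⟩, s, hsy, fun r => ?_, ?_⟩
  · rw [AffineMap.lineMap_apply_module, map_add, map_smul, map_smul, smul_eq_mul, smul_eq_mul]
    set q := D.root s x / (D.root s x - D.root s y)
    rcases lt_or_ge (D.root r y) 0 with hr | hr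
    · have := hmin r (by simp [hr])
      rw [le_div_iff₀ (by linarith [hx r])] at this
      linarith
    · exact add_nonneg (mul_nonneg (by linarith) (hx r)) (mul_nonneg ht0 hr)
  · rw [AffineMap.lineMap_apply_module, map_add, map_smul, map_smul, smul_eq_mul, smul_eq_mul]
    field_simp
    ring

end Words

section Positivity

variable {S V : Type*} [AddCommGroup V] [Module ℝ V]

theorem segment_subset_union {x y z : V} (hz : z ∈ segment ℝ x y) :
    segment ℝ x y ⊆ segment ℝ x z ∪ segment ℝ z y := by
  rw [segment_eq_image_lineMap] at hz ⊢
  obtain ⟨t, ht, rfl⟩ := hz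
  rintro _ ⟨r, hr, rfl⟩
  have key : ∀ a b : ℝ, r ∈ Icc a b → AffineMap.lineMap x y r ∈
      segment ℝ (AffineMap.lineMap x y a) (AffineMap.lineMap x y b : V) := by
    intro a b hab
    rw [← image_segment, segment_eq_Icc (hab.1.trans hab.2)]
    exact mem_image_of_mem _ hab
  rcases le_total r t with h | h
  · exact Or.inl (by simpa using key 0 t ⟨hr.1, h⟩)
  · exact Or.inr (by simpa using key t 1 ⟨h, hr.2⟩)

/-- Finitely many strict inequalities survive a small displacement. -/
theorem exists_forall_pos [Finite S] {f g : S → ℝ} (hf : ∀ s, 0 < f s) :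
    ∃ ε : ℝ, 0 < ε ∧ ∀ s, 0 < f s + ε * g s := by
  have h : ∀ᶠ ε : ℝ in 𝓝[>] 0, ∀ s, 0 < f s + ε * g s := by
    rw [eventually_all]
    intro s
    have hc : Tendsto (fun ε : ℝ => f s + ε * g s) (𝓝[>] 0) (𝓝 (f s + 0 * g s)) :=
      (Continuous.tendsto (by fun_prop) 0).mono_left nhdsWithin_le_nhds
    refine hc.eventually (lt_mem_nhds ?_)
    simpa using hf s
  obtain ⟨ε, h1, h2⟩ := (h.and self_mem_nhdsWithin).exists
  exact ⟨ε, h2, h1⟩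

variable [TopologicalSpace V] [IsTopologicalAddGroup V] [ContinuousSMul ℝ V]

/-- A functional that is nonnegative near a point of `U`, within `U`, and vanishes at that point,
vanishes on `U`. -/
theorem eq_zero_of_nonneg_nhdsWithin {U : Submodule ℝ V} {f : Module.Dual ℝ V} {x : V}
    (hx : x ∈ U) (hf : ∀ᶠ y in 𝓝[U] x, 0 ≤ f y) (h0 : f x = 0) {u : V} (hu : u ∈ U) :
    f u = 0 := by
  have key : ∀ u ∈ U, 0 ≤ f u := by
    intro u hu
    have hc : Tendsto (fun ε : ℝ => x + ε • u) (𝓝[>] 0) (𝓝[U] x) := by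
      refine tendsto_nhdsWithin_iff.2 ⟨?_, Eventually.of_forall fun ε =>
        U.add_mem hx (U.smul_mem _ hu)⟩
      have : Tendsto (fun ε : ℝ => x + ε • u) (𝓝 0) (𝓝 (x + (0 : ℝ) • u)) :=
        Continuous.tendsto (by fun_prop) 0
      simpa using this.mono_left nhdsWithin_le_nhds
    obtain ⟨ε, h1, h2⟩ := ((hc.eventually hf).and self_mem_nhdsWithin).exists
    rw [map_add, map_smul, h0, zero_add, smul_eq_mul] at h1
    exact nonneg_of_mul_nonneg_right h1 h2
  have h1 := key u hu
  have h2 := key (-u) (U.neg_mem hu)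
  rw [map_neg] at h2
  linarith

theorem exists_sub_smul_mem {U : Submodule ℝ V} {X : Set V} {p y : V} (hp : p ∈ U) (hy : y ∈ U)
    (hX : X ∈ 𝓝[U] p) : ∃ ε : ℝ, 0 < ε ∧ p - ε • y ∈ X := by
  have hc : Tendsto (fun ε : ℝ => p - ε • y) (𝓝[>] 0) (𝓝[U] p) := by
    refine tendsto_nhdsWithin_iff.2 ⟨?_, Eventually.of_forall fun ε =>
      U.sub_mem hp (U.smul_mem _ hy)⟩
    have : Tendsto (fun ε : ℝ => p - ε • y) (𝓝 0) (𝓝 (p - (0 : ℝ) • y)) :=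
      Continuous.tendsto (by fun_prop) 0
    simpa using this.mono_left nhdsWithin_le_nhds
  obtain ⟨ε, h1, h2⟩ := ((hc.eventually hX).and self_mem_nhdsWithin).exists
  exact ⟨ε, h2, h1⟩

theorem root_pos_of_mem_interior {D : ReflectionData S V} {x : V}
    (hx : x ∈ interior D.chamber) (s : S) :
    0 < D.root s x := by
  refine lt_of_le_of_ne (interior_subset hx s) fun h => ?_
  have h2 := eq_zero_of_nonneg_nhdsWithin (U := ⊤) (f := D.root s) (x := x) trivial
    (nhdsWithin_le_nhds (Filter.mem_of_superset (mem_interior_iff_mem_nhds.1 hx)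
      fun y (hy : y ∈ D.chamber) => hy s)) h.symm (u := D.coroot s) trivial
  rw [D.root_coroot_two] at h2
  norm_num at h2

theorem IsLinearCoxeterSystem.exists_base {D : ReflectionData S V}
    (hD : D.IsLinearCoxeterSystem) : ∃ k, ∀ s, 0 < D.root s k :=
  hD.interior_nonempty.imp fun _ hk => root_pos_of_mem_interior hk

end Positivity

section Coxeter

variable {S V : Type*} [AddCommGroup V] [Module ℝ V] [FiniteDimensional ℝ V]
  [TopologicalSpace V] [IsTopologicalAddGroup V] [ContinuousSMul ℝ V] [T2Space V]
  {D : ReflectionData S V}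

theorem continuous_root (D : ReflectionData S V) (s : S) : Continuous (D.root s) :=
  (D.root s).continuous_of_finiteDimensional

theorem continuous_equiv (w : V ≃ₗ[ℝ] V) : Continuous w :=
  w.toLinearMap.continuous_of_finiteDimensional

theorem isClosed_chamber (D : ReflectionData S V) : IsClosed D.chamber := by
  simp only [chamber, ofPred_forall]
  exact isClosed_iInter fun s => isClosed_le continuous_const (D.continuous_root s)

theorem mem_interior_chamber [Finite S] {x : V} :
    x ∈ interior D.chamber ↔ ∀ s, 0 < D.root s x := by
  refine ⟨root_pos_of_mem_interior, fun h => ?_⟩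
  have ho : IsOpen {y | ∀ s, 0 < D.root s y} := by
    simp only [ofPred_forall]
    exact isOpen_iInter_of_finite fun s => isOpen_lt continuous_const (D.continuous_root s)
  exact interior_maximal (fun y hy s => (hy s).le) ho h

namespace IsLinearCoxeterSystem

/-- The chambers `w K°` are pairwise distinct: a Weyl group element that maps an interior point of
`K` to an interior point of `K` is trivial. -/
theorem eq_one_of_pos (hD : D.IsLinearCoxeterSystem) {w : V ≃ₗ[ℝ] V} (hw : w ∈ D.weylGroup)
    {x : V} (hx : ∀ s, 0 < D.root s x) (hwx : ∀ s, 0 < D.root s (w x)) : w = 1 := by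
  have := hD.finite_index
  by_contra hne
  have h := hD.disjoint_chambers w hw hne
  have : w x ∈ w '' interior D.chamber ∩ interior D.chamber :=
    ⟨mem_image_of_mem _ (mem_interior_chamber.2 hx), mem_interior_chamber.2 hwx⟩
  rw [h] at this
  exact this

/-- The wall `ker α_s` contains no interior point of a chamber `w K`. -/
theorem root_ne_zero (hD : D.IsLinearCoxeterSystem) {w : V ≃ₗ[ℝ] V} (hw : w ∈ D.weylGroup)
    (s : S) {x : V} (hx : ∀ s, 0 < D.root s x) : D.root s (w x) ≠ 0 := by
  intro h
  have hfix : D.reflection s (w x) = w x := by simp [reflection_apply, h]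
  have h1 : w⁻¹ * D.reflection s * w = 1 := by
    refine hD.eq_one_of_pos (mul_mem (mul_mem (inv_mem hw) (D.reflection_mem s)) hw) hx ?_
    simpa only [LinearEquiv.mul_apply, hfix, inv_apply_self'] using hx
  have h2 : D.reflection s = 1 := by
    rw [mul_assoc, inv_mul_eq_one] at h1
    exact (mul_eq_right).1 h1.symm
  have h3 : D.reflection s (D.coroot s) = D.coroot s := by rw [h2]; rfl
  have h4 := D.root_reflection_self s (D.coroot s)
  rw [h3, D.root_coroot_two] at h4
  norm_num at h4

/-- A root is nonpositive on the whole chamber `w K` as soon as it is negative somewhere on it, and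
then it is negative on the interior. -/
theorem root_neg_of_exists_neg (hD : D.IsLinearCoxeterSystem) {w : V ≃ₗ[ℝ] V}
    (hw : w ∈ D.weylGroup) {s : S} {k : V} (hk : k ∈ D.chamber) (hneg : D.root s (w k) < 0)
    {x : V} (hx : ∀ s, 0 < D.root s x) : D.root s (w x) < 0 := by
  have hne := hD.root_ne_zero hw s hx
  by_contra hcon
  have hpos : 0 < D.root s (w x) := lt_of_le_of_ne (not_lt.1 hcon) hne.symm
  -- The root vanishes at this positive combination of `x` and `k`, an interior point of `K`.
  refine hD.root_ne_zero hw s (x := (-D.root s (w k)) • x + D.root s (w x) • k) ?_ ?_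
  · intro t
    simp only [map_add, map_smul, smul_eq_mul]
    exact add_pos_of_pos_of_nonneg (mul_pos (neg_pos.2 hneg) (hx t)) (mul_nonneg hpos.le (hk t))
  · simp only [map_add, map_smul, smul_eq_mul]
    ring

theorem root_nonpos_of_exists_neg (hD : D.IsLinearCoxeterSystem) {w : V ≃ₗ[ℝ] V}
    (hw : w ∈ D.weylGroup) {s : S} {k : V} (hk : k ∈ D.chamber) (hneg : D.root s (w k) < 0)
    {x : V} (hx : x ∈ D.chamber) : D.root s (w x) ≤ 0 := by
  obtain ⟨k₀, hk₀⟩ := hD.exists_base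
  by_contra! hpos
  have h := hD.root_neg_of_exists_neg hw hk hneg hk₀
  -- A large multiple of `x` outweighs `k₀`.
  have h2 := hD.root_neg_of_exists_neg hw hk hneg
    (x := k₀ + (-D.root s (w k₀) / D.root s (w x)) • x) (fun t => by
      simp only [map_add, map_smul, smul_eq_mul]
      exact add_pos_of_pos_of_nonneg (hk₀ t)
        (mul_nonneg (div_nonneg (neg_nonneg.2 h.le) hpos.le) (hx t)))
  simp only [map_add, map_smul, smul_eq_mul, div_mul_cancel₀ _ hpos.ne'] at h2
  linarith

/-- Each `ker α_t` is a genuine wall of `K`: some point of it satisfies all the other inequalities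
strictly. -/
theorem exists_wall_point (hD : D.IsLinearCoxeterSystem) (t : S) :
    ∃ x, D.root t x = 0 ∧ ∀ s, s ≠ t → 0 < D.root s x := by
  have := hD.finite_index
  obtain ⟨k, hk⟩ := hD.exists_base
  obtain ⟨y, hy, hy'⟩ := exists_neg_of_notMem_hull (Set.toFinite _) (hD.root_notMem t)
  refine ⟨(-D.root t y) • k + D.root t k • y, ?_, fun s hs => ?_⟩
  · simp only [map_add, map_smul, smul_eq_mul]; ring
  · simp only [map_add, map_smul, smul_eq_mul]
    exact add_pos_of_pos_of_nonneg (mul_pos (neg_pos.2 hy) (hk s))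
      (mul_nonneg (hk t).le (hy' _ (mem_image_of_mem _ hs)))

/-- If the wall `ker α_s` separates the adjacent chambers `u K` and `u r_t K`, then it is their
common wall and `r_s u = u r_t`. -/
theorem reflection_mul_eq (hD : D.IsLinearCoxeterSystem) {u : V ≃ₗ[ℝ] V} (hu : u ∈ D.weylGroup)
    {s t : S} (hpos : ∀ k, (∀ s, 0 < D.root s k) → 0 < D.root s (u k))
    (hneg : ∀ k ∈ D.chamber, D.root s (u (D.reflection t k)) ≤ 0) :
    D.reflection s * u = u * D.reflection t := by
  have := hD.finite_index
  obtain ⟨k₀, hk₀⟩ := hD.exists_base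
  obtain ⟨x, hx0, hx⟩ := hD.exists_wall_point t
  have hge : ∀ k ∈ D.chamber, 0 ≤ D.root s (u k) := by
    intro k hk
    by_contra! h
    exact lt_asymm (hpos k₀ hk₀) (hD.root_neg_of_exists_neg hu hk h hk₀)
  have hvan : ∀ k ∈ D.chamber, D.root t k = 0 → D.root s (u k) = 0 := by
    intro k hk hk0
    refine le_antisymm ?_ (hge k hk)
    have := hneg k hk
    rwa [reflection_apply, hk0, zero_smul, sub_zero] at this
  have hxK : x ∈ D.chamber := fun r => by
    by_cases h : r = t
    · rw [h, hx0]
    · exact (hx r h).le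
  have hker : ∀ y, D.root t y = 0 → D.root s (u y) = 0 := by
    intro y hy
    obtain ⟨ε, hε, h⟩ := exists_forall_pos (S := {r // r ≠ t}) (f := fun r => D.root r x)
      (g := fun r => D.root r y) (fun r => hx r r.2)
    have hmem : x + ε • y ∈ D.chamber := fun r => by
      by_cases hr : r = t
      · subst hr; simp [hx0, hy]
      · have := (h ⟨r, hr⟩).le
        simpa using this
    have h1 := hvan _ hmem (by simp [hx0, hy])
    rw [map_add, map_add, hvan x hxK hx0, zero_add, map_smul, map_smul, smul_eq_mul] at h1
    exact (mul_eq_zero.1 h1).resolve_left hε.ne'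
  -- Hence `α_s ∘ u` is a positive multiple of `α_t`.
  have hmul : ∀ y, D.root s (u y) = D.root t y * (D.root s (u (D.coroot t)) / 2) := by
    intro y
    have := hker (y - (D.root t y / 2) • D.coroot t) (by
      simp [D.root_coroot_two])
    simp only [map_sub, map_smul, smul_eq_mul] at this
    linarith
  set c := D.root s (u (D.coroot t)) / 2 with hc_def
  have hc : 0 < c := by
    have h1 := hpos k₀ hk₀
    rw [hmul] at h1
    exact pos_of_mul_pos_right h1 (hk₀ t).le
  set ρ : V ≃ₗ[ℝ] V := u⁻¹ * D.reflection s * u with hρ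
  have hρW : ρ ∈ D.weylGroup := mul_mem (mul_mem (inv_mem hu) (D.reflection_mem s)) hu
  have hρx : ρ x = x := by
    have : D.reflection s (u x) = u x := by simp [reflection_apply, hvan x hxK hx0]
    simp only [hρ, LinearEquiv.mul_apply, this, inv_apply_self']
  have hρk : D.root t (ρ k₀) = - D.root t k₀ := by
    have h1 : D.root s (u (ρ k₀)) = - D.root s (u k₀) := by
      simp only [hρ, LinearEquiv.mul_apply, apply_inv_self', root_reflection_self]
    rw [hmul, hmul k₀] at h1
    have h2 : (D.root t (ρ k₀) + D.root t k₀) * c = 0 := by linarith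
    have := (mul_eq_zero.1 h2).resolve_right hc.ne'
    linarith
  -- Both `ρ` and `r_t` fold the half-space at `x` over, so `r_t ρ` maps a point of `K°` close to
  -- `x` into `K°`.
  obtain ⟨ε, hε, h⟩ := exists_forall_pos (S := {r // r ≠ t}) (f := fun r => D.root r x)
      (g := fun r => D.root r (D.reflection t (ρ k₀))) (fun r => hx r r.2)
  have htx : D.reflection t x = x := by simp [reflection_apply, hx0]
  have h1 : D.reflection t * ρ = 1 := by
    refine hD.eq_one_of_pos (mul_mem (D.reflection_mem t) hρW) (x := x + ε • k₀) ?_ ?_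
    · intro r
      rw [map_add, map_smul, smul_eq_mul]
      exact add_pos_of_nonneg_of_pos (hxK r) (mul_pos hε (hk₀ r))
    · intro r
      rw [LinearEquiv.mul_apply, map_add ρ, hρx, map_smul ρ, map_add (D.reflection t), htx,
        map_smul (D.reflection t), map_add, map_smul, smul_eq_mul]
      by_cases hr : r = t
      · subst hr
        rw [hx0, zero_add, root_reflection_self, hρk, neg_neg]
        exact mul_pos hε (hk₀ r)
      · exact h ⟨r, hr⟩
  have h2 : ρ = D.reflection t := by
    rw [← D.reflection_inv t]
    exact (inv_eq_of_mul_eq_one_right h1).symm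
  rw [← h2, hρ]
  group

/-- The exchange condition, for a gallery that starts at the chamber `u K`. -/
theorem exchange_aux (hD : D.IsLinearCoxeterSystem) {s : S} (l : List S) :
    ∀ u ∈ D.weylGroup, (∀ k, (∀ s, 0 < D.root s k) → 0 < D.root s (u k)) →
      (∀ k, (∀ s, 0 < D.root s k) → D.root s (u (D.wordProd l k)) < 0) →
      ∃ l' : List S, l'.length + 1 = l.length ∧
        D.reflection s * (u * D.wordProd l) = u * D.wordProd l' := by
  obtain ⟨k₀, hk₀⟩ := hD.exists_base
  induction l with
  | nil =>
    intro u hu hpos hneg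
    exact absurd (hpos k₀ hk₀) (lt_asymm (hneg k₀ hk₀))
  | cons t l ih =>
    intro u hu hpos hneg
    have hut : u * D.reflection t ∈ D.weylGroup := mul_mem hu (D.reflection_mem t)
    by_cases h : ∃ k ∈ D.chamber, D.root s ((u * D.reflection t) k) < 0
    · obtain ⟨k, hk, hlt⟩ := h
      have := hD.reflection_mul_eq hu hpos (t := t)
        (fun y hy => hD.root_nonpos_of_exists_neg hut hk hlt hy)
      refine ⟨l, by simp, ?_⟩
      rw [wordProd_cons, ← mul_assoc, this, mul_assoc, ← mul_assoc (D.reflection t),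
        reflection_mul_self, one_mul]
    · push Not at h
      obtain ⟨l', hl', heq⟩ := ih (u * D.reflection t) hut
        (fun k hk => lt_of_le_of_ne (h k fun r => (hk r).le) (hD.root_ne_zero hut s hk).symm)
        (fun k hk => by simpa using hneg k hk)
      refine ⟨t :: l', by simp [hl'], ?_⟩
      rw [wordProd_cons, wordProd_cons, ← mul_assoc u, heq, mul_assoc]

/-- If `α_s` is negative somewhere on `w K`, then multiplication by `r_s` shortens `w`. -/
theorem length_reflection_mul_lt (hD : D.IsLinearCoxeterSystem) {w : V ≃ₗ[ℝ] V}
    (hw : w ∈ D.weylGroup) {s : S} {k : V} (hk : k ∈ D.chamber) (hneg : D.root s (w k) < 0) :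
    D.length (D.reflection s * w) < D.length w := by
  obtain ⟨l, hl, rfl⟩ := D.exists_reduced_word hw
  obtain ⟨l', hl', heq⟩ := hD.exchange_aux (s := s) l 1 (one_mem _) (fun k hk => hk s)
    (fun x hx => hD.root_neg_of_exists_neg hw hk hneg hx)
  rw [one_mul, one_mul] at heq
  rw [heq, ← hl]
  have := D.length_wordProd_le l'
  omega

theorem exists_root_neg (hD : D.IsLinearCoxeterSystem) {w : V ≃ₗ[ℝ] V}
    (hw : w ∈ D.weylGroup) (hne : w ≠ 1) {k : V} (hk : ∀ s, 0 < D.root s k) :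
    ∃ s, D.root s (w k) < 0 := by
  by_contra! h
  exact hne (hD.eq_one_of_pos hw hk fun s =>
    lt_of_le_of_ne (h s) (hD.root_ne_zero hw s hk).symm)

/-- Induction along reduced words: `w` may be assumed shortened by a reflection `r_s` whose root is
nonpositive on `w K`. -/
theorem length_induction (hD : D.IsLinearCoxeterSystem) {P : (V ≃ₗ[ℝ] V) → Prop} (one : P 1)
    (step : ∀ w ∈ D.weylGroup, ∀ s, (∀ k ∈ D.chamber, D.root s (w k) ≤ 0) →
      D.length (D.reflection s * w) < D.length w → P (D.reflection s * w) → P w)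
    {w : V ≃ₗ[ℝ] V} (hw : w ∈ D.weylGroup) : P w := by
  obtain ⟨k₀, hk₀⟩ := hD.exists_base
  induction hn : D.length w using Nat.strong_induction_on generalizing w with
  | _ n ih =>
    by_cases h1 : w = 1
    · rwa [h1]
    · obtain ⟨s, hs⟩ := hD.exists_root_neg hw h1 hk₀
      have hk : k₀ ∈ D.chamber := fun s => (hk₀ s).le
      have hlt := hD.length_reflection_mul_lt hw hk hs
      exact step w hw s (fun k hk' => hD.root_nonpos_of_exists_neg hw hk hs hk') hlt
        (ih _ (hn ▸ hlt) (mul_mem (D.reflection_mem s) hw) rfl)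

theorem segment_subset_titsCone_of_mem_chamber (hD : D.IsLinearCoxeterSystem) {w : V ≃ₗ[ℝ] V}
    (hw : w ∈ D.weylGroup) {x k : V} (hx : x ∈ D.chamber) (hk : k ∈ D.chamber) :
    segment ℝ x (w k) ⊆ D.titsCone := by
  have := hD.finite_index
  induction hn : D.length w using Nat.strong_induction_on generalizing w x with
  | _ n ih =>
    by_cases hy : w k ∈ D.chamber
    · exact (D.convex_chamber.segment_subset hx hy).trans D.chamber_subset_titsCone
    · obtain ⟨t, ht, s, hs, hz, hz0⟩ := D.exists_exit hx hy
      set z := AffineMap.lineMap x (w k) t with hz_def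
      have hlt := hD.length_reflection_mul_lt hw hk hs
      have hsub := ih _ (hn ▸ hlt) (mul_mem (D.reflection_mem s) hw) hz rfl
      have hfix : D.reflection s z = z := by simp [reflection_apply, hz0]
      have hseg2 : segment ℝ z (w k) ⊆ D.titsCone := by
        intro p hp
        have : D.reflection s p ∈ segment ℝ z ((D.reflection s * w) k) := by
          have h := mem_image_of_mem (D.reflection s).toLinearMap hp
          rw [← LinearMap.coe_toAffineMap, image_segment] at h
          simpa [hfix] using h
        have := D.apply_mem_titsCone (D.reflection_mem s) (hsub this)
        rwa [reflection_reflection] at this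
      have hmem : z ∈ segment ℝ x (w k) := by
        rw [segment_eq_image_lineMap]
        exact mem_image_of_mem _ ht
      intro p hp
      rcases segment_subset_union hmem hp with h | h
      · exact D.chamber_subset_titsCone (D.convex_chamber.segment_subset hx hz h)
      · exact hseg2 h

theorem convex_titsCone (hD : D.IsLinearCoxeterSystem) : Convex ℝ D.titsCone := by
  rw [convex_iff_segment_subset]
  rintro _ ⟨u, hu, x, hx, rfl⟩ _ ⟨w, hw, k, hk, rfl⟩ p hp
  have hsub := hD.segment_subset_titsCone_of_mem_chamber (mul_mem (inv_mem hu) hw) hx hk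
  have : u⁻¹ p ∈ segment ℝ x ((u⁻¹ * w) k) := by
    have h := mem_image_of_mem (u⁻¹).toLinearMap hp
    rw [← LinearMap.coe_toAffineMap, image_segment] at h
    simpa [inv_apply_self'] using h
  have := D.apply_mem_titsCone hu (hsub this)
  rwa [apply_inv_self'] at this

theorem add_mem_titsCone (hD : D.IsLinearCoxeterSystem) {x y : V} (hx : x ∈ D.titsCone)
    (hy : y ∈ D.titsCone) : x + y ∈ D.titsCone := by
  have h := hD.convex_titsCone hx hy (a := 1 / 2) (b := 1 / 2) (by norm_num) (by norm_num)
    (by norm_num)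
  have := D.smul_mem_titsCone h (c := 2) (by norm_num)
  simpa [smul_smul] using this

end IsLinearCoxeterSystem

end Coxeter

end ReflectionData

/-! ### Orbits and the cones generated by coroots -/

namespace ReflectionData

section Roots

variable {S V : Type*} [AddCommGroup V] [Module ℝ V] {D : ReflectionData S V}

theorem self_mem_orbit (v : V) : v ∈ D.orbit v := ⟨1, one_mem _, rfl⟩

theorem apply_mem_orbit {w : V ≃ₗ[ℝ] V} (hw : w ∈ D.weylGroup) {v x : V} (hx : x ∈ D.orbit v) :
    w x ∈ D.orbit v := by
  obtain ⟨u, hu, rfl⟩ := hx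
  exact ⟨w * u, mul_mem hw hu, rfl⟩

theorem orbit_apply {w : V ≃ₗ[ℝ] V} (hw : w ∈ D.weylGroup) (v : V) :
    D.orbit (w v) = D.orbit v := by
  ext x
  constructor
  · rintro ⟨u, hu, rfl⟩
    exact ⟨u * w, mul_mem hu hw, rfl⟩
  · rintro ⟨u, hu, rfl⟩
    exact ⟨u * w⁻¹, mul_mem hu (inv_mem hw), by simp [LinearEquiv.mul_apply, inv_apply_self']⟩

theorem isRootCorootPair_simple (s : S) : D.IsRootCorootPair (D.root s) (D.coroot s) :=
  ⟨1, one_mem _, s, by ext; simp, rfl⟩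

theorem IsRootCorootPair.apply {α : Module.Dual ℝ V} {a : V} (h : D.IsRootCorootPair α a)
    {w : V ≃ₗ[ℝ] V} (hw : w ∈ D.weylGroup) :
    D.IsRootCorootPair (α ∘ₗ ((w⁻¹ : V ≃ₗ[ℝ] V) : V →ₗ[ℝ] V)) (w a) := by
  obtain ⟨u, hu, s, rfl, rfl⟩ := h
  refine ⟨w * u, mul_mem hw hu, s, ?_, rfl⟩
  rw [mul_inv_rev]
  rfl

/-- The reflection in any root maps a point into its own orbit. -/
theorem IsRootCorootPair.sub_smul_mem_orbit {α : Module.Dual ℝ V} {a : V}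
    (h : D.IsRootCorootPair α a) (v : V) : v - α v • a ∈ D.orbit v := by
  obtain ⟨w, hw, s, rfl, rfl⟩ := h
  refine ⟨w * D.reflection s * w⁻¹, mul_mem (mul_mem hw (D.reflection_mem s)) (inv_mem hw), ?_⟩
  simp [LinearEquiv.mul_apply, reflection_apply]

theorem apply_mem_coneAt {w : V ≃ₗ[ℝ] V} (hw : w ∈ D.weylGroup) {v c : V}
    (hc : c ∈ D.coneAt v) : w c ∈ D.coneAt (w v) := by
  have : D.coneAt v ≤ (D.coneAt (w v)).comap (w : V →ₗ[ℝ] V) := by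
    refine Submodule.span_le.2 ?_
    rintro a ⟨α, hα, hpos⟩
    refine PointedCone.subset_hull ⟨_, hα.apply hw, ?_⟩
    simpa [inv_apply_self'] using hpos
  exact this hc

theorem apply_mem_coneAt_iff {w : V ≃ₗ[ℝ] V} (hw : w ∈ D.weylGroup) {v c : V} :
    w c ∈ D.coneAt (w v) ↔ c ∈ D.coneAt v := by
  refine ⟨fun h => ?_, apply_mem_coneAt hw⟩
  simpa [inv_apply_self'] using apply_mem_coneAt (inv_mem hw) h

/-- A cone that contains all the differences `v - x`, for `x` in the orbit of `v`, contains `C_v`,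
since the reflections in roots move `v` along the coroots. -/
theorem coneAt_le {v : V} {C : PointedCone ℝ V} (hC : ∀ x ∈ D.orbit v, v - x ∈ C) :
    D.coneAt v ≤ C := by
  refine Submodule.span_le.2 ?_
  rintro a ⟨α, hα, hpos⟩
  have h := hC _ (hα.sub_smul_mem_orbit v)
  rw [sub_sub_cancel] at h
  have := C.smul_mem (inv_nonneg.2 hpos.le) h
  rwa [inv_smul_smul₀ hpos.ne'] at this

variable (D) in
/-- The cone generated by the simple coroots `α_s^∨` whose root `α_s` does not vanish on the
subspace `U`. -/
def coneOn (U : Submodule ℝ V) : PointedCone ℝ V :=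
  PointedCone.hull ℝ (D.coroot '' {s | ∃ u ∈ U, D.root s u ≠ 0})

variable (D) in
/-- The cone generated by the images of the simple coroots `α_s^∨` with `α_s(v) > 0` under the
stabilizer of `v` in the Weyl group. -/
def stabilizerCone (v : V) : PointedCone ℝ V :=
  PointedCone.hull ℝ {a | ∃ u ∈ D.weylGroup, u v = v ∧ ∃ s, 0 < D.root s v ∧ a = u (D.coroot s)}

theorem apply_mem_stabilizerCone {w : V ≃ₗ[ℝ] V} (hw : w ∈ D.weylGroup) {v c : V} (hv : w v = v)
    (hc : c ∈ D.stabilizerCone v) : w c ∈ D.stabilizerCone v := by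
  have : D.stabilizerCone v ≤ (D.stabilizerCone v).comap (w : V →ₗ[ℝ] V) := by
    refine Submodule.span_le.2 ?_
    rintro a ⟨u, hu, huv, s, hs, rfl⟩
    refine PointedCone.subset_hull ⟨w * u, mul_mem hw hu, ?_, s, hs, rfl⟩
    rw [LinearEquiv.mul_apply, huv, hv]
  exact this hc

theorem stabilizerCone_le_coneAt (v : V) : D.stabilizerCone v ≤ D.coneAt v := by
  refine Submodule.span_le.2 ?_
  rintro a ⟨u, hu, huv, s, hs, rfl⟩
  refine PointedCone.subset_hull ⟨_, (isRootCorootPair_simple s).apply hu, ?_⟩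
  have : u⁻¹ v = v := by
    conv_lhs => rw [← huv]
    exact inv_apply_self' u v
  change 0 < D.root s (u⁻¹ v)
  rwa [this]

theorem coneOn_top : D.coneOn ⊤ = D.simpleCone := by
  have : {s | ∃ u ∈ (⊤ : Submodule ℝ V), D.root s u ≠ 0} = univ := by
    ext s
    simp only [mem_ofPred_eq, mem_univ, iff_true]
    exact ⟨D.coroot s, trivial, by simp [D.root_coroot_two]⟩
  rw [coneOn, this, image_univ, simpleCone]

end Roots

section Orbits

variable {S V : Type*} [AddCommGroup V] [Module ℝ V] [FiniteDimensional ℝ V]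
  [TopologicalSpace V] [IsTopologicalAddGroup V] [ContinuousSMul ℝ V] [T2Space V]
  {D : ReflectionData S V}

namespace IsLinearCoxeterSystem

/-- Any point of the orbit of `v ∈ K` is reached from `v` by simple reflections, each of which
moves the point to the negative side of its wall. -/
theorem orbit_induction (hD : D.IsLinearCoxeterSystem) {v : V} (hv : v ∈ D.chamber)
    {P : V → Prop} (base : P v)
    (step : ∀ x ∈ D.orbit v, ∀ s, D.root s x < 0 → P (D.reflection s x) → P x)
    {x : V} (hx : x ∈ D.orbit v) : P x := by
  obtain ⟨w, hw, rfl⟩ := hx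
  refine hD.length_induction (P := fun w => P (w v)) base ?_ hw
  intro w hw s hs _ ih
  rcases (hs v hv).lt_or_eq with h | h
  · exact step _ ⟨w, hw, rfl⟩ s h ih
  · have hfix : (D.reflection s * w) v = w v := by simp [reflection_apply, h]
    rwa [hfix] at ih

theorem sub_mem_stabilizerCone (hD : D.IsLinearCoxeterSystem) {v : V} (hv : v ∈ D.chamber)
    {x : V} (hx : x ∈ D.orbit v) : v - x ∈ D.stabilizerCone v := by
  refine hD.orbit_induction hv (P := fun x => v - x ∈ D.stabilizerCone v) (by simp) ?_ hx
  intro x _ s hs ih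
  rcases (hv s).lt_or_eq with hpos | h0
  · have hmem : D.coroot s ∈ D.stabilizerCone v :=
      PointedCone.subset_hull ⟨1, one_mem _, rfl, s, hpos, rfl⟩
    have := add_mem ih (PointedCone.smul_mem _ (neg_nonneg.2 hs.le) hmem)
    rw [reflection_apply] at this
    convert this using 1
    module
  · have hfix : D.reflection s v = v := by simp [reflection_apply, ← h0]
    have := apply_mem_stabilizerCone (D.reflection_mem s) hfix ih
    rwa [map_sub, hfix, reflection_reflection] at this

/-- For `v ∈ K`, the cone `C_v` is generated by the images of finitely many coroots under the
stabilizer of `v`. -/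
theorem coneAt_eq_stabilizerCone (hD : D.IsLinearCoxeterSystem) {v : V} (hv : v ∈ D.chamber) :
    D.coneAt v = D.stabilizerCone v :=
  le_antisymm (coneAt_le fun _ hx => hD.sub_mem_stabilizerCone hv hx)
    (stabilizerCone_le_coneAt v)

theorem sub_mem_coneOn (hD : D.IsLinearCoxeterSystem) {v : V} (hv : v ∈ D.chamber)
    {U : Submodule ℝ V} (hU : D.orbit v ⊆ U) {x : V} (hx : x ∈ D.orbit v) :
    v - x ∈ D.coneOn U := by
  refine hD.orbit_induction hv (P := fun x => v - x ∈ D.coneOn U) (by simp) ?_ hx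
  intro x hxo s hs ih
  have hmem : D.coroot s ∈ D.coneOn U :=
    PointedCone.subset_hull (mem_image_of_mem _ ⟨x, hU hxo, hs.ne⟩)
  have := add_mem ih (PointedCone.smul_mem _ (neg_nonneg.2 hs.le) hmem)
  rw [reflection_apply] at this
  convert this using 1
  module

theorem coneAt_le_coneOn (hD : D.IsLinearCoxeterSystem) {v : V} (hv : v ∈ D.chamber)
    {U : Submodule ℝ V} (hU : D.orbit v ⊆ U) : D.coneAt v ≤ D.coneOn U :=
  coneAt_le fun _ hx => hD.sub_mem_coneOn hv hU hx

/-- The orbit of a point `v` of the Tits cone lies in `v - C_v`. -/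
theorem sub_mem_coneAt (hD : D.IsLinearCoxeterSystem) {v : V} (hv : v ∈ D.titsCone)
    {x : V} (hx : x ∈ D.orbit v) : v - x ∈ D.coneAt v := by
  obtain ⟨g, hg, k, hk, rfl⟩ := hv
  rw [orbit_apply hg] at hx
  have h := stabilizerCone_le_coneAt k
    (hD.sub_mem_stabilizerCone hk (apply_mem_orbit (inv_mem hg) hx))
  have := apply_mem_coneAt hg h
  rwa [map_sub, apply_inv_self'] at this

end IsLinearCoxeterSystem

end Orbits

end ReflectionData

/-! ### Separation relative to an invariant subspace -/

namespace ReflectionData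

section Relative

variable {S V : Type*} [AddCommGroup V] [Module ℝ V] [FiniteDimensional ℝ V]
  [TopologicalSpace V] [IsTopologicalAddGroup V] [ContinuousSMul ℝ V] [T2Space V]
  {D : ReflectionData S V}

theorem tendsto_nhdsWithin_apply {U : Submodule ℝ V} {w : V ≃ₗ[ℝ] V} (hw : ∀ u ∈ U, w u ∈ U)
    (x : V) : Tendsto w (𝓝[U] x) (𝓝[U] (w x)) :=
  ((continuous_equiv w).tendsto x).inf (tendsto_principal_principal.2 hw)

namespace IsLinearCoxeterSystem

/-- If the Tits cone has interior relative to an invariant subspace `U`, then so does the chamber: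
the countably many chambers cover the Tits cone, so this is a case of the Baire category theorem. -/
theorem exists_chamber_mem_nhdsWithin (hD : D.IsLinearCoxeterSystem) {U : Submodule ℝ V}
    (hU : ∀ w ∈ D.weylGroup, ∀ u ∈ U, w u ∈ U) {a : V} (haU : a ∈ U)
    (ha : D.titsCone ∈ 𝓝[U] a) : ∃ y ∈ U, D.chamber ∈ 𝓝[U] y := by
  have := hD.finite_index
  have : BaireSpace U := (toEuclidean (E := U)).symm.toHomeomorph.baireSpace
  let N : Set U := interior ((↑) ⁻¹' D.titsCone)
  have haN : (⟨a, haU⟩ : U) ∈ N :=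
    mem_interior_iff_mem_nhds.2 (preimage_coe_mem_nhds_subtype.2 ha)
  let F : Option (List S) → Set U := fun o =>
    o.elim Nᶜ fun l => {u | (D.wordProd l)⁻¹ (u : V) ∈ D.chamber}
  have hF : ∀ o, IsClosed (F o) := by
    rintro (_ | l)
    · exact isOpen_interior.isClosed_compl
    · exact D.isClosed_chamber.preimage
        ((continuous_equiv _).comp continuous_subtype_val)
  have hcover : ⋃ o, F o = univ := by
    refine eq_univ_of_forall fun u => ?_
    by_cases hu : u ∈ N
    · obtain ⟨w, hw, k, hk, hwk⟩ := interior_subset hu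
      obtain ⟨l, rfl⟩ := D.exists_wordProd_eq hw
      refine mem_iUnion.2 ⟨some l, ?_⟩
      change (D.wordProd l)⁻¹ (u : V) ∈ D.chamber
      rwa [hwk, inv_apply_self']
    · exact mem_iUnion.2 ⟨none, hu⟩
  obtain ⟨u, huN, hu⟩ := (dense_iUnion_interior_of_closed hF hcover).inter_open_nonempty N
    isOpen_interior ⟨_, haN⟩
  obtain ⟨o, ho⟩ := mem_iUnion.1 hu
  rcases o with _ | l
  · exact absurd huN (interior_subset ho)
  · have hinv := inv_mem (D.wordProd_mem l)
    refine ⟨(D.wordProd l)⁻¹ u, hU _ hinv u u.2, ?_⟩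
    have h1 : {x : V | (D.wordProd l)⁻¹ x ∈ D.chamber} ∈ 𝓝[U] (u : V) :=
      preimage_coe_mem_nhds_subtype.1 (mem_interior_iff_mem_nhds.1 ho)
    have h2 := tendsto_nhdsWithin_apply (hU _ (D.wordProd_mem l)) ((D.wordProd l)⁻¹ u)
    rw [apply_inv_self'] at h2
    filter_upwards [h2 h1] with x hx
    simpa only [mem_preimage, mem_ofPred_eq, inv_apply_self'] using hx

/-- Let `p ∈ K` be an interior point, relative to an invariant subspace `U`, of the Tits cone. Then
the stabilizer of `p` acts on `U` through elements of bounded length, hence through a finite group.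
The bound is the length of a chamber that contains `p - ε y`, where `y` is a relative interior point
of `K`. -/
theorem exists_length_le_of_stabilizer (hD : D.IsLinearCoxeterSystem) {U : Submodule ℝ V}
    (hU : ∀ w ∈ D.weylGroup, ∀ u ∈ U, w u ∈ U) {y : V} (hyU : y ∈ U)
    (hy : D.chamber ∈ 𝓝[U] y) {p : V} (hp : p ∈ D.chamber) {ε : ℝ} (hε : 0 < ε)
    (hpy : p - ε • y ∈ D.titsCone) :
    ∃ n, ∀ u ∈ D.weylGroup, u p = p →
      ∃ u' ∈ D.weylGroup, (∀ x ∈ U, u' x = u x) ∧ D.length u' ≤ n := by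
  obtain ⟨w, hw, k, hk, hwk⟩ := hpy
  have hyK : y ∈ D.chamber := mem_of_mem_nhdsWithin hyU hy
  have key : ∀ u ∈ D.weylGroup, u p = p → ∃ u' ∈ D.weylGroup, u' p = p ∧
      (∀ x ∈ U, u'⁻¹ x = u x) ∧ D.length (u'⁻¹ * w) + D.length u' ≤ D.length w := by
    intro u hu
    refine hD.length_induction (P := fun u => u p = p → ∃ u' ∈ D.weylGroup, u' p = p ∧
      (∀ x ∈ U, u'⁻¹ x = u x) ∧ D.length (u'⁻¹ * w) + D.length u' ≤ D.length w) ?_ ?_ hu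
    · intro _
      refine ⟨1, one_mem _, rfl, fun x _ => by rw [inv_one], ?_⟩
      have := D.length_wordProd_le []
      simpa using this
    · intro u hu s hs _ ih hup
      have hsp : D.root s p = 0 := by
        refine le_antisymm ?_ (hp s)
        have := hs p hp
        rwa [hup] at this
      have hrp : D.reflection s p = p := by simp [reflection_apply, hsp]
      obtain ⟨u', hu', hu'p, hu'U, hlen⟩ := ih (by rw [LinearEquiv.mul_apply, hup, hrp])
      by_cases hsU : ∀ x ∈ U, D.root s x = 0
      · refine ⟨u', hu', hu'p, fun x hx => ?_, hlen⟩
        rw [hu'U x hx, LinearEquiv.mul_apply, reflection_apply, hsU _ (hU u hu x hx), zero_smul,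
          sub_zero]
      · have hsy : D.root s (u y) < 0 := by
          refine lt_of_le_of_ne (hs y hyK) fun h0 => hsU fun x hx => ?_
          have h := eq_zero_of_nonneg_nhdsWithin (U := U)
            (f := -(D.root s ∘ₗ (u : V →ₗ[ℝ] V))) hyU
            (by filter_upwards [hy] with z hz using by simpa using hs z hz)
            (by simpa using h0) (hU _ (inv_mem hu) x hx)
          simp only [LinearMap.neg_apply, LinearMap.comp_apply, LinearEquiv.coe_coe,
            apply_inv_self', neg_eq_zero] at h
          exact h
        have hu'pinv : u'⁻¹ p = p := by
          conv_lhs => rw [← hu'p]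
          exact inv_apply_self' u' p
        have hneg : D.root s ((u'⁻¹ * w) k) < 0 := by
          rw [LinearEquiv.mul_apply, ← hwk, map_sub, hu'pinv, map_smul, hu'U y hyU,
            LinearEquiv.mul_apply, map_sub, hsp, map_smul, root_reflection_self, smul_eq_mul]
          nlinarith
        have hlt := hD.length_reflection_mul_lt (mul_mem (inv_mem hu') hw) hk hneg
        refine ⟨u' * D.reflection s, mul_mem hu' (D.reflection_mem s), ?_, fun x hx => ?_, ?_⟩
        · rw [LinearEquiv.mul_apply, hrp, hu'p]
        · rw [mul_inv_rev, reflection_inv, LinearEquiv.mul_apply, hu'U x hx,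
            LinearEquiv.mul_apply, reflection_reflection]
        · have := D.length_mul_reflection_le hu' s
          rw [mul_inv_rev, reflection_inv, mul_assoc]
          omega
  refine ⟨D.length w, fun u hu hup => ?_⟩
  have huinv : u⁻¹ p = p := by
    conv_lhs => rw [← hup]
    exact inv_apply_self' u p
  obtain ⟨u', hu', -, hu'U, hlen⟩ := key u⁻¹ (inv_mem hu) huinv
  refine ⟨u', hu', fun x hx => ?_, by omega⟩
  have h := hu'U (u x) (hU u hu x hx)
  rw [inv_apply_self'] at h
  conv_lhs => rw [← h]
  exact apply_inv_self' u' (u x)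

/-- For a point `v` of the chamber in the interior of the Tits cone, the stabilizer is finite, and
so `C_v` is finitely generated. -/
theorem isClosed_coneAt_of_mem_chamber (hD : D.IsLinearCoxeterSystem) {v : V}
    (hv : v ∈ D.chamber) (hvi : v ∈ interior D.titsCone) :
    IsClosed (D.coneAt v : Set V) := by
  have := hD.finite_index
  obtain ⟨y, hy⟩ := hD.interior_nonempty
  have hy' : D.chamber ∈ 𝓝[(⊤ : Submodule ℝ V)] y :=
    nhdsWithin_le_nhds (mem_interior_iff_mem_nhds.1 hy)
  obtain ⟨ε, hε, h⟩ := exists_sub_smul_mem (U := ⊤) (p := v) (y := y) trivial trivial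
    (nhdsWithin_le_nhds (mem_interior_iff_mem_nhds.1 hvi))
  obtain ⟨n, hn⟩ := hD.exists_length_le_of_stabilizer (U := ⊤) (fun _ _ _ _ => trivial)
    trivial hy' hv hε h
  rw [hD.coneAt_eq_stabilizerCone hv]
  refine isClosed_hull_of_finite (((D.finite_length_le n).prod (Set.toFinite univ)).image
    (fun q : (V ≃ₗ[ℝ] V) × S => q.1 (D.coroot q.2)) |>.subset ?_)
  rintro a ⟨u, hu, huv, s, -, rfl⟩
  obtain ⟨u', hu', heq, hlen⟩ := hn u hu huv
  exact ⟨(u', s), ⟨⟨hu', hlen⟩, trivial⟩, heq _ trivial⟩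

theorem titsCone_mem_nhdsWithin_lineMap (hD : D.IsLinearCoxeterSystem) {U : Submodule ℝ V}
    {a x : V} (haT : D.titsCone ∈ 𝓝[U] a) (hxU : x ∈ U) (hx : x ∈ D.titsCone)
    {t : ℝ} (ht : t ∈ Ioc (0 : ℝ) 1) : D.titsCone ∈ 𝓝[U] (AffineMap.lineMap x a t) := by
  have hφ : Tendsto (fun p => AffineMap.lineMap x p t⁻¹) (𝓝[U] (AffineMap.lineMap x a t))
      (𝓝[U] a) := by
    refine tendsto_nhdsWithin_iff.2 ⟨?_, ?_⟩
    · have hc : Continuous fun p : V => AffineMap.lineMap x p t⁻¹ := by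
        simp only [AffineMap.lineMap_apply_module]
        fun_prop
      have := hc.tendsto (AffineMap.lineMap x a t)
      have h2 : AffineMap.lineMap x (AffineMap.lineMap x a t) t⁻¹ = a := by
        simp [AffineMap.lineMap_apply, smul_smul, inv_mul_cancel₀ ht.1.ne']
      rw [h2] at this
      exact this.mono_left nhdsWithin_le_nhds
    · filter_upwards [self_mem_nhdsWithin] with p hp
      rw [AffineMap.lineMap_apply_module]
      exact U.add_mem (U.smul_mem _ hxU) (U.smul_mem _ hp)
  filter_upwards [hφ haT] with p hp
  have h := hD.convex_titsCone hx hp (sub_nonneg.2 ht.2) ht.1.le (by ring)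
  beta_reduce at h
  rw [AffineMap.lineMap_apply_module, smul_add, smul_smul, smul_smul,
    mul_inv_cancel₀ ht.1.ne'] at h
  convert h using 1
  have : (1 - t) + t * (1 - t⁻¹) = 0 := by
    rw [mul_sub, mul_inv_cancel₀ ht.1.ne']; ring
  rw [← add_assoc, ← add_smul, this, zero_smul, zero_add, one_smul]

/-- The separation argument. Let `A` be a closed convex invariant subset of an invariant subspace
`U` that meets the interior, relative to `U`, of the Tits cone. A point `x ∈ U` of the Tits cone
whose orbit lies in `v - C` for some `v ∈ A`, where `C` is the closure of the cone generated by the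
simple coroots visible on `U`, belongs to `A`. -/
theorem mem_of_forall_sub_mem (hD : D.IsLinearCoxeterSystem) {U : Submodule ℝ V}
    (hU : ∀ w ∈ D.weylGroup, ∀ u ∈ U, w u ∈ U) {A : Set V} (hAc : IsClosed A)
    (hAconv : Convex ℝ A) (hAU : A ⊆ U) (hA : ∀ w ∈ D.weylGroup, ∀ b ∈ A, w b ∈ A)
    {a : V} (haA : a ∈ A) (haT : D.titsCone ∈ 𝓝[U] a) {v : V} (hvA : v ∈ A)
    {x : V} (hxU : x ∈ U) (hxT : x ∈ D.titsCone)
    (hx : ∀ w ∈ D.weylGroup, v - w x ∈ closure (D.coneOn U : Set V)) : x ∈ A := by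
  obtain ⟨y, hyU, hy⟩ := hD.exists_chamber_mem_nhdsWithin hU (hAU haA) haT
  have := hD.finite_index
  have hcont : Continuous fun t : ℝ => AffineMap.lineMap x a t := by
    simp only [AffineMap.lineMap_apply_module]
    fun_prop
  -- The first point of `A` on the segment from `x` to `a`.
  obtain ⟨t₀, ⟨ht₀, ht₀A⟩, hmin⟩ := (isCompact_Icc.inter_right (hAc.preimage hcont)
    : IsCompact (Icc (0 : ℝ) 1 ∩ _)).exists_isLeast ⟨1, by simp, by simpa using haA⟩
  rcases ht₀.1.eq_or_lt with h0 | hpos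
  · subst h0; simpa using ht₀A
  exfalso
  have hT₀ := hD.titsCone_mem_nhdsWithin_lineMap haT hxU hxT ⟨hpos, ht₀.2⟩
  obtain ⟨M, hM, hMU⟩ := mem_nhdsWithin_iff_exists_mem_nhds_inter.1
    (eventually_eventually_nhdsWithin.2 hT₀)
  have hev := (hcont.tendsto t₀).mono_left (nhdsWithin_le_nhds (s := Iio t₀)) |>.eventually
    (eventually_exists_support hAc hAconv ht₀A hM)
  obtain ⟨t, ht, htpos⟩ := (hev.and (Ioo_mem_nhdsLT hpos)).exists
  obtain ⟨p, ⟨hpA, hpM⟩, f, hfmax, hfz⟩ := ht fun h =>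
    not_lt.2 (hmin ⟨⟨htpos.1.le, htpos.2.le.trans ht₀.2⟩, h⟩) htpos.2
  have hpU := hAU hpA
  have hpT : D.titsCone ∈ 𝓝[U] p := hMU ⟨hpM, hpU⟩
  obtain ⟨g, hg, k, hk, rfl⟩ := mem_of_mem_nhdsWithin hpU hpT
  obtain ⟨ε, hε, hpε⟩ := exists_sub_smul_mem hpU (hU g hg y hyU) hpT
  have hkε : k - ε • y ∈ D.titsCone := by
    have := D.apply_mem_titsCone (inv_mem hg) hpε
    rwa [map_sub, map_smul, inv_apply_self', inv_apply_self'] at this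
  obtain ⟨n, hn⟩ := hD.exists_length_le_of_stabilizer hU hyU hy hk hε hkε
  -- If `u` in the stabilizer of `k` maximizes `f (g u y)`, then `f ∘ g ∘ u` is dominant.
  have hfin : ((fun u : V ≃ₗ[ℝ] V => f (g (u y))) ''
      {u | u ∈ D.weylGroup ∧ u k = k}).Finite := by
    refine ((D.finite_length_le n).image fun u : V ≃ₗ[ℝ] V => f (g (u y))).subset ?_
    rintro _ ⟨u, ⟨hu, huk⟩, rfl⟩
    obtain ⟨u', hu', heq, hlen⟩ := hn u hu huk
    exact ⟨u', ⟨hu', hlen⟩, by simp only [heq y hyU]⟩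
  obtain ⟨_, ⟨u, ⟨hu, huk⟩, rfl⟩, hmax⟩ := hfin.exists_maximal
    ⟨_, mem_image_of_mem _ ⟨one_mem _, rfl⟩⟩
  have hyK : y ∈ D.chamber := mem_of_mem_nhdsWithin hyU hy
  have hgu : g * u ∈ D.weylGroup := mul_mem hg hu
  let f' : Module.Dual ℝ V := f ∘ₗ ((g * u : V ≃ₗ[ℝ] V) : V →ₗ[ℝ] V)
  have hf' : ∀ z, f' z = f (g (u z)) := fun z => rfl
  have hkA : k ∈ A := by simpa [inv_apply_self'] using hA _ (inv_mem hg) _ hpA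
  have hf'max : ∀ b ∈ A, f' b ≤ f' k := by
    intro b hb
    rw [hf', hf', huk]
    exact hfmax _ (hA _ hg _ (hA _ hu _ hb))
  have hdom : ∀ s, (∃ z ∈ U, D.root s z ≠ 0) → 0 ≤ f' (D.coroot s) := by
    rintro s ⟨z, hzU, hz⟩
    rcases (hk s).eq_or_lt with h | h
    · have hys : 0 < D.root s y := by
        refine lt_of_le_of_ne (hyK s) fun h0 => hz ?_
        exact eq_zero_of_nonneg_nhdsWithin hyU
          (by filter_upwards [hy] with q hq using hq s) h0.symm hzU
      have hsk : D.reflection s k = k := by simp [reflection_apply, ← h]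
      have hle : f' (D.reflection s y) ≤ f' y := by
        have hmem : f (g ((u * D.reflection s) y)) ∈ (fun u : V ≃ₗ[ℝ] V => f (g (u y))) ''
            {u | u ∈ D.weylGroup ∧ u k = k} :=
          ⟨u * D.reflection s, ⟨mul_mem hu (D.reflection_mem s), by
            rw [LinearEquiv.mul_apply, hsk, huk]⟩, rfl⟩
        rcases le_total (f (g ((u * D.reflection s) y))) (f (g (u y))) with hle | hle
        · exact hle
        · exact hmax hmem hle
      rw [reflection_apply, map_sub, map_smul, smul_eq_mul] at hle
      exact nonneg_of_mul_nonneg_right (by linarith) hys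
    · have hle := hf'max _ (hA _ (D.reflection_mem s) _ hkA)
      rw [reflection_apply, map_sub, map_smul, smul_eq_mul] at hle
      exact nonneg_of_mul_nonneg_right (by linarith) h
  have hcone : ∀ c ∈ closure (D.coneOn U : Set V), 0 ≤ f' c := by
    have hcl : IsClosed {c | 0 ≤ f' c} :=
      isClosed_le continuous_const f'.continuous_of_finiteDimensional
    refine fun c hc => closure_minimal (fun c hc => ?_) hcl hc
    refine Submodule.span_induction (p := fun c _ => 0 ≤ f' c) ?_ ?_ ?_ ?_ hc
    · rintro _ ⟨s, hs, rfl⟩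
      exact hdom s hs
    · simp
    · intro c d _ _ hc hd
      rw [map_add]; exact add_nonneg hc hd
    · intro r c _ hc
      have : f' (r • c) = (r : ℝ) * f' c := by
        rw [← smul_eq_mul, ← map_smul]; rfl
      rw [this]
      exact mul_nonneg r.2 hc
  have hwx : f' ((g * u)⁻¹ x) ≤ f' k := by
    have := hcone _ (hx _ (inv_mem hgu))
    rw [map_sub] at this
    linarith [hf'max v hvA]
  have hwa : f' ((g * u)⁻¹ a) ≤ f' k := hf'max _ (hA _ (inv_mem hgu) _ haA)
  have hback : ∀ z, f' ((g * u)⁻¹ z) = f z := fun z => by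
    change f ((g * u) ((g * u)⁻¹ z)) = f z
    rw [apply_inv_self']
  rw [hback, hf', huk] at hwx hwa
  rw [AffineMap.lineMap_apply_module, map_add, map_smul, map_smul, smul_eq_mul,
    smul_eq_mul] at hfz
  have ht1 : t ≤ 1 := htpos.2.le.trans ht₀.2
  nlinarith [mul_le_mul_of_nonneg_left hwx (sub_nonneg.2 ht1),
    mul_le_mul_of_nonneg_left hwa htpos.1.le]

end IsLinearCoxeterSystem

end Relative

end ReflectionData

/-! ### Orbits in the interior of the Tits cone -/

namespace ReflectionData

section DualFamilies

variable {E : Type*} [AddCommGroup E] [Module ℝ E] [FiniteDimensional ℝ E]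

/-- A maximal linearly independent subfamily of `t` extending `s`, together with functionals dual
to it. -/
theorem exists_dual_family [DecidableEq E] {s t : Set E} (hs : LinearIndepOn ℝ id s) (hst : s ⊆ t) :
    ∃ (b : Set E) (φ : b → Module.Dual ℝ E), b.Finite ∧ b ⊆ t ∧ s ⊆ b ∧
      (∀ i j : b, φ j (i : E) = if i = j then 1 else 0) ∧
      ∀ [Fintype b], ∀ x ∈ Submodule.span ℝ t, x = ∑ i : b, φ i x • (i : E) := by
  obtain ⟨b, hbt, hsb, hspan, hb⟩ := exists_linearIndepOn_id_extension hs hst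
  have hli : LinearIndependent ℝ ((↑) : b → E) := hb
  have hφ : ∀ j : b, ∃ φ : Module.Dual ℝ E, ∀ i : b, φ (i : E) = if i = j then 1 else 0 := by
    intro j
    obtain ⟨φ, hφ⟩ := LinearMap.exists_extend (Finsupp.lapply j ∘ₗ hli.repr)
    refine ⟨φ, fun i => ?_⟩
    have hmem : (i : E) ∈ Submodule.span ℝ (range ((↑) : b → E)) :=
      Submodule.subset_span (mem_range_self i)
    have h := LinearMap.congr_fun hφ ⟨i, hmem⟩
    rw [LinearMap.comp_apply, LinearMap.comp_apply,
      hli.repr_eq_single i ⟨i, hmem⟩ rfl] at h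
    simpa [Finsupp.single_apply] using h
  choose φ hφ using hφ
  refine ⟨b, φ, hli.setFinite, hbt, hsb, fun i j => hφ j i, ?_⟩
  intro _ x hx
  have hx' : x ∈ Submodule.span ℝ (range ((↑) : b → E)) := by
    rw [Subtype.range_coe]
    exact Submodule.span_le.2 hspan hx
  obtain ⟨c, rfl⟩ := (Submodule.mem_span_range_iff_exists_fun ℝ).1 hx'
  refine Finset.sum_congr rfl fun i _ => ?_
  simp [map_sum, hφ]

end DualFamilies

section Interior

variable {S V : Type*} [AddCommGroup V] [Module ℝ V] [FiniteDimensional ℝ V]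
  [TopologicalSpace V] [IsTopologicalAddGroup V] [ContinuousSMul ℝ V] [T2Space V]
  {D : ReflectionData S V}

variable (D) in
/-- The cone of functionals that are nonnegative on the Tits cone. -/
def titsDual : Set (Module.Dual ℝ V) := {h | ∀ y ∈ D.titsCone, 0 ≤ h y}

theorem comp_mem_titsDual {h : Module.Dual ℝ V} (hh : h ∈ D.titsDual) {w : V ≃ₗ[ℝ] V}
    (hw : w ∈ D.weylGroup) : h ∘ₗ (w : V →ₗ[ℝ] V) ∈ D.titsDual :=
  fun _ hy => hh _ (D.apply_mem_titsCone hw hy)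

theorem smul_mem_interior_titsCone {v : V} (hv : v ∈ interior D.titsCone) {c : ℝ} (hc : 0 < c) :
    c • v ∈ interior D.titsCone := by
  have ho : IsOpen ((c • ·) '' interior D.titsCone) :=
    (Homeomorph.smulOfNeZero c hc.ne').isOpenMap _ isOpen_interior
  refine interior_maximal ?_ ho (mem_image_of_mem _ hv)
  rintro _ ⟨y, hy, rfl⟩
  exact D.smul_mem_titsCone (interior_subset hy) hc.le

/-- On functionals nonnegative on the Tits cone, evaluation at any vector is dominated by
evaluation at an interior point. -/
theorem exists_abs_le {v : V} (hv : v ∈ interior D.titsCone) (e : V) :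
    ∃ C : ℝ, 0 ≤ C ∧ ∀ h ∈ D.titsDual, |h e| ≤ C * h v := by
  have hn : D.titsCone ∈ 𝓝[(⊤ : Submodule ℝ V)] v :=
    nhdsWithin_le_nhds (mem_interior_iff_mem_nhds.1 hv)
  obtain ⟨ε₁, h1, h1'⟩ := exists_sub_smul_mem (U := ⊤) (y := e) trivial trivial hn
  obtain ⟨ε₂, h2, h2'⟩ := exists_sub_smul_mem (U := ⊤) (y := -e) trivial trivial hn
  refine ⟨ε₁⁻¹ + ε₂⁻¹, by positivity, fun h hh => ?_⟩
  have hv0 := hh v (interior_subset hv)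
  have ha := hh _ h1'
  have hb := hh _ h2'
  simp only [map_sub, map_smul, map_neg, smul_eq_mul] at ha hb
  have ha' : h e ≤ ε₁⁻¹ * h v := by
    rw [inv_mul_eq_div, le_div_iff₀ h1]; linarith
  have hb' : -h e ≤ ε₂⁻¹ * h v := by
    rw [inv_mul_eq_div, le_div_iff₀ h2]; linarith
  have p1 := mul_nonneg (inv_nonneg.2 h1.le) hv0
  have p2 := mul_nonneg (inv_nonneg.2 h2.le) hv0
  rw [abs_le]
  constructor <;> nlinarith

section Determinant

variable {ι : Type*} [Fintype ι] [DecidableEq ι] {b : ι → Module.Dual ℝ V} {e : ι → V}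

/-- The Weyl group acts with determinant `±1` on the span of the functionals that are nonnegative
on the Tits cone, since it is generated by involutions. -/
theorem abs_det_eq_one (hb : ∀ i, b i ∈ D.titsDual)
    (hdual : ∀ i j, b i (e j) = if i = j then 1 else 0)
    (hexp : ∀ h ∈ D.titsDual, ∀ x, h x = ∑ k, h (e k) * b k x)
    {w : V ≃ₗ[ℝ] V} (hw : w ∈ D.weylGroup) :
    |(Matrix.of fun i j => b i (w (e j))).det| = 1 := by
  have hmul : ∀ w₁ ∈ D.weylGroup, ∀ w₂ : V ≃ₗ[ℝ] V,
      (Matrix.of fun i j => b i ((w₁ * w₂) (e j))) =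
        (Matrix.of fun i j => b i (w₁ (e j))) * Matrix.of fun i j => b i (w₂ (e j)) := by
    intro w₁ hw₁ w₂
    ext i j
    rw [Matrix.mul_apply]
    exact hexp _ (comp_mem_titsDual (hb i) hw₁) (w₂ (e j))
  have hone : (Matrix.of fun i j => b i ((1 : V ≃ₗ[ℝ] V) (e j))) = 1 := by
    ext i j
    simp [hdual, Matrix.one_apply]
  have hrefl : ∀ s, |(Matrix.of fun i j => b i (D.reflection s (e j))).det| = 1 := by
    intro s
    have h := hmul _ (D.reflection_mem s) (D.reflection s)
    rw [reflection_mul_self, hone] at h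
    have h2 := congrArg Matrix.det h
    rw [Matrix.det_one, Matrix.det_mul] at h2
    rcases mul_self_eq_one_iff.1 h2.symm with h3 | h3 <;> simp [h3]
  obtain ⟨l, rfl⟩ := D.exists_wordProd_eq hw
  induction l with
  | nil => rw [wordProd_nil, hone, Matrix.det_one, abs_one]
  | cons s l ih =>
    rw [wordProd_cons, hmul _ (D.reflection_mem s), Matrix.det_mul, abs_mul, hrefl, one_mul]
    exact ih (D.wordProd_mem l)

/-- A family of functionals, nonnegative on the Tits cone and of determinant `±1`, has at an
interior point `v` a sum that is bounded below by a constant depending on `v` only. -/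
theorem exists_le_sum_of_abs_det_eq_one [Nonempty ι] (e : ι → V) {v : V}
    (hv : v ∈ interior D.titsCone) :
    ∃ c : ℝ, 0 < c ∧ ∀ H : ι → Module.Dual ℝ V, (∀ i, H i ∈ D.titsDual) →
      |(Matrix.of fun i j => H i (e j)).det| = 1 → c ≤ ∑ i, H i v := by
  choose C hC0 hC using fun j => exists_abs_le hv (e j)
  set C' := ∑ j, C j with hC'
  have hC'0 : 0 ≤ C' := Finset.sum_nonneg fun j _ => hC0 j
  set n := Fintype.card ι with hn
  have hn0 : n ≠ 0 := Fintype.card_ne_zero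
  have hlim : Tendsto (fun c : ℝ => (n.factorial : ℝ) * (C' * c) ^ n) (𝓝[>] 0) (𝓝 0) := by
    have : Tendsto (fun c : ℝ => (n.factorial : ℝ) * (C' * c) ^ n) (𝓝 0)
        (𝓝 ((n.factorial : ℝ) * (C' * 0) ^ n)) := Continuous.tendsto (by fun_prop) 0
    rw [mul_zero, zero_pow hn0, mul_zero] at this
    exact this.mono_left nhdsWithin_le_nhds
  obtain ⟨c, hc1, hc0⟩ := ((hlim.eventually (gt_mem_nhds one_pos)).and
    self_mem_nhdsWithin).exists
  refine ⟨c, hc0, fun H hH hdet => ?_⟩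
  by_contra! hlt
  have hHv : ∀ i, 0 ≤ H i v := fun i => hH i v (interior_subset hv)
  have hentry : ∀ i j, |(Matrix.of fun i j => H i (e j)) i j| ≤ C' * c := by
    intro i j
    have h1 : C j ≤ C' := Finset.single_le_sum (fun j _ => hC0 j) (Finset.mem_univ j)
    have h2 : H i v ≤ ∑ i, H i v := Finset.single_le_sum (fun i _ => hHv i) (Finset.mem_univ i)
    calc |H i (e j)| ≤ C j * H i v := hC j _ (hH i)
      _ ≤ C' * c := mul_le_mul h1 (h2.trans hlt.le) (hHv i) hC'0
  have h := Matrix.det_le (abv := AbsoluteValue.abs) hentry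
  simp only [AbsoluteValue.abs_apply, hdet, nsmul_eq_mul] at h
  linarith

end Determinant

namespace IsLinearCoxeterSystem

theorem add_mem_interior_titsCone (hD : D.IsLinearCoxeterSystem) {v y : V}
    (hv : v ∈ interior D.titsCone) (hy : y ∈ D.titsCone) : v + y ∈ interior D.titsCone := by
  have ho : IsOpen ((· + y) '' interior D.titsCone) :=
    (Homeomorph.addRight y).isOpenMap _ isOpen_interior
  refine interior_maximal ?_ ho (mem_image_of_mem _ hv)
  rintro _ ⟨z, hz, rfl⟩
  exact hD.add_mem_titsCone (interior_subset hz) hy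

/-- A point outside the interior of the Tits cone is separated from it by a nonzero functional that
is nonnegative on the Tits cone. -/
theorem exists_titsDual_nonpos (hD : D.IsLinearCoxeterSystem) {v : V}
    (hv : v ∈ interior D.titsCone) {p : V} (hp : p ∉ interior D.titsCone) :
    ∃ h ∈ D.titsDual, h ≠ 0 ∧ h p ≤ 0 := by
  obtain ⟨f, hf⟩ := geometric_hahn_banach_point_open hD.convex_titsCone.interior
    isOpen_interior hp
  refine ⟨f.toLinearMap, fun y hy => ?_, fun h0 => ?_, ?_⟩
  · by_contra! hneg
    have hneg' : f y < 0 := hneg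
    have hc : 0 ≤ (f v - f p) / (-f y) :=
      div_nonneg (sub_nonneg.2 (hf v hv).le) (neg_nonneg.2 hneg'.le)
    have h := hf _ (hD.add_mem_interior_titsCone hv (D.smul_mem_titsCone hy hc))
    rw [map_add, map_smul, smul_eq_mul, div_neg, neg_mul, div_mul_cancel₀ _ hneg'.ne] at h
    linarith
  · have h := hf v hv
    have h1 : f v = 0 := LinearMap.congr_fun h0 v
    have h2 : f p = 0 := LinearMap.congr_fun h0 p
    rw [h1, h2] at h
    exact lt_irrefl _ h
  · by_contra! hpos
    have hpos' : 0 < f p := hpos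
    have hfv := hpos'.trans (hf v hv)
    have h := hf _ (smul_mem_interior_titsCone hv (div_pos hpos' hfv))
    rw [map_smul, smul_eq_mul, div_mul_cancel₀ _ hfv.ne'] at h
    exact lt_irrefl _ h

/-- The closed convex hull of an orbit in the interior of the Tits cone stays in the interior.

If `h₀` is a functional in the dual cone that is nonpositive at a point `p` outside, extend it to a
basis of the span of the dual cone, multiply `h₀` by a large factor and the other members by a small
`ε` so that the determinant remains `1`. The sum of the family is bounded below on the orbit, by a
constant independent of `ε`, and it is at most a multiple of `ε` at `p`. -/
theorem closedConvexHull_orbit_subset_interior (hD : D.IsLinearCoxeterSystem) {v : V}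
    (hv : v ∈ interior D.titsCone) :
    closedConvexHull ℝ (D.orbit v) ⊆ interior D.titsCone := by
  classical
  intro p hp
  by_contra hpi
  obtain ⟨h₀, hh₀, hne, hle⟩ := hD.exists_titsDual_nonpos hv hpi
  have hsing : LinearIndepOn ℝ id ({h₀} : Set (Module.Dual ℝ V)) :=
    LinearIndepOn.singleton hne
  obtain ⟨B, φ, hfin, hBt, hB0, hφ, hexp⟩ := exists_dual_family hsing
    (singleton_subset_iff.2 hh₀)
  have := hfin.fintype
  let e : B → V := fun i => (Module.evalEquiv ℝ V).symm (φ i)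
  have he : ∀ (h : Module.Dual ℝ V) i, h (e i) = φ i h := fun h i => by
    change h ((Module.evalEquiv ℝ V).symm (φ i)) = φ i h
    exact Module.apply_evalEquiv_symm_apply ℝ V h (φ i)
  have hb : ∀ i : B, (i : Module.Dual ℝ V) ∈ D.titsDual := fun i => hBt i.2
  have hdual : ∀ i j : B, (i : Module.Dual ℝ V) (e j) = if i = j then 1 else 0 :=
    fun i j => by rw [he, hφ]
  have hexp' : ∀ h ∈ D.titsDual, ∀ x, h x = ∑ k : B, h (e k) * (k : Module.Dual ℝ V) x := by
    intro h hh x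
    conv_lhs => rw [hexp h (Submodule.subset_span hh)]
    simp [he]
  let i₀ : B := ⟨h₀, hB0 rfl⟩
  have : Nonempty B := ⟨i₀⟩
  obtain ⟨c, hc, hsum⟩ := exists_le_sum_of_abs_det_eq_one e hv
  let n := Fintype.card B
  have key : ∀ ε : ℝ, 0 < ε → c ≤ ε * ∑ i : B, |(i : Module.Dual ℝ V) p| := by
    intro ε hε
    let μ : B → ℝ := fun i => ε * if i = i₀ then (ε ^ n)⁻¹ else 1
    have hμ0 : ∀ i, 0 < μ i := fun i => by
      simp only [μ]
      split_ifs <;> positivity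
    have hμ : ∏ i, μ i = 1 := by
      simp only [μ, Finset.prod_mul_distrib, Finset.prod_const, Finset.prod_ite_eq',
        Finset.mem_univ, if_true, Finset.card_univ]
      exact mul_inv_cancel₀ (pow_pos hε _).ne'
    let F : Module.Dual ℝ V := ∑ i : B, μ i • (i : Module.Dual ℝ V)
    have hF : ∀ x, F x = ∑ i : B, μ i * (i : Module.Dual ℝ V) x := fun x => by simp [F]
    have horb : ∀ x ∈ D.orbit v, c ≤ F x := by
      rintro _ ⟨w, hw, rfl⟩
      have h := hsum (fun i => μ i • ((i : Module.Dual ℝ V) ∘ₗ (w : V →ₗ[ℝ] V)))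
        (fun i y hy => mul_nonneg (hμ0 i).le (comp_mem_titsDual (hb i) hw y hy)) ?_
      · rw [hF]; exact h
      · have hmat : (Matrix.of fun i j : B =>
            (μ i • ((i : Module.Dual ℝ V) ∘ₗ (w : V →ₗ[ℝ] V))) (e j)) =
            Matrix.diagonal μ * Matrix.of fun i j : B => (i : Module.Dual ℝ V) (w (e j)) := by
          ext i j
          simp [Matrix.diagonal_mul]
        rw [hmat, Matrix.det_mul, Matrix.det_diagonal, hμ, one_mul]
        exact abs_det_eq_one (b := fun i : B => (i : Module.Dual ℝ V)) hb hdual hexp' hw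
    have hcl : IsClosed {x | c ≤ F x} :=
      isClosed_le continuous_const F.continuous_of_finiteDimensional
    have hconv : Convex ℝ {x | c ≤ F x} := convex_halfSpace_ge F.isLinear c
    have hFp : c ≤ F p := closedConvexHull_min horb hconv hcl hp
    refine hFp.trans ?_
    rw [hF, Finset.mul_sum]
    refine Finset.sum_le_sum fun i _ => ?_
    by_cases hi : i = i₀
    · have h1 : (i : Module.Dual ℝ V) p ≤ 0 := by rw [hi]; exact hle
      exact (mul_nonpos_of_nonneg_of_nonpos (hμ0 i).le h1).trans (by positivity)
    · simp only [μ, if_neg hi, mul_one]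
      exact mul_le_mul_of_nonneg_left (le_abs_self _) hε.le
  set Q := ∑ i : B, |(i : Module.Dual ℝ V) p|
  have hQ : 0 ≤ Q := Finset.sum_nonneg fun i _ => abs_nonneg _
  have h := key (c / (2 * (Q + 1))) (by positivity)
  rw [div_mul_eq_mul_div, le_div_iff₀ (by positivity)] at h
  nlinarith

end IsLinearCoxeterSystem

end Interior

end ReflectionData

/-! ### The convex hull of an orbit -/

namespace ReflectionData

section Hull

variable {S V : Type*} [AddCommGroup V] [Module ℝ V] [FiniteDimensional ℝ V]
  [TopologicalSpace V] [IsTopologicalAddGroup V] [ContinuousSMul ℝ V] [T2Space V]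
  {D : ReflectionData S V}

theorem apply_mem_closedConvexHull {v : V} {w : V ≃ₗ[ℝ] V} (hw : w ∈ D.weylGroup) {x : V}
    (hx : x ∈ closedConvexHull ℝ (D.orbit v)) : w x ∈ closedConvexHull ℝ (D.orbit v) := by
  refine closedConvexHull_min (t := w ⁻¹' closedConvexHull ℝ (D.orbit v)) ?_ ?_ ?_ hx
  · exact fun y hy => subset_closedConvexHull (apply_mem_orbit hw hy)
  · exact (convex_closedConvexHull (𝕜 := ℝ)).linear_preimage w.toLinearMap
  · exact isClosed_closedConvexHull.preimage (continuous_equiv w)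

theorem apply_mem_closure_coneAt {w : V ≃ₗ[ℝ] V} (hw : w ∈ D.weylGroup) {v c : V}
    (hc : c ∈ closure (D.coneAt v : Set V)) : w c ∈ closure (D.coneAt (w v) : Set V) :=
  map_mem_closure (continuous_equiv w) hc fun _ h => apply_mem_coneAt hw h

variable (D) in
theorem mem_iInter_image_iff {v x : V} {Z : Set V} :
    x ∈ ⋂ w ∈ D.weylGroup, (fun c => w (v - c)) '' Z ↔
      ∀ w ∈ D.weylGroup, v - w x ∈ Z := by
  simp only [mem_iInter]
  constructor
  · intro h w hw
    obtain ⟨c, hc, hcx⟩ := h w⁻¹ (inv_mem hw)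
    rw [← hcx]
    change v - w (w⁻¹ (v - c)) ∈ Z
    rwa [apply_inv_self', sub_sub_cancel]
  · intro h w hw
    refine ⟨v - w⁻¹ x, h _ (inv_mem hw), ?_⟩
    change w (v - (v - w⁻¹ x)) = x
    rw [sub_sub_cancel, apply_inv_self']

namespace IsLinearCoxeterSystem

theorem sub_mem_closure_coneAt (hD : D.IsLinearCoxeterSystem) {v : V} (hv : v ∈ D.titsCone)
    {x : V} (hx : x ∈ closedConvexHull ℝ (D.orbit v)) :
    v - x ∈ closure (D.coneAt v : Set V) := by
  refine closedConvexHull_min (t := (fun x => v - x) ⁻¹' closure (D.coneAt v : Set V)) ?_ ?_ ?_ hx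
  · exact fun y hy => subset_closure (hD.sub_mem_coneAt hv hy)
  · intro y hy z hz a b ha hb hab
    have h := (D.coneAt v).convex.closure hy hz ha hb hab
    change v - (a • y + b • z) ∈ closure (D.coneAt v : Set V)
    convert h using 1
    rw [smul_sub, smul_sub, sub_add_sub_comm, ← add_smul, hab, one_smul]
  · exact isClosed_closure.preimage (by fun_prop)

/-- Relative to the span of an orbit in the Tits cone, the convex hull of the orbit meets the
interior of the Tits cone. -/
theorem exists_mem_convexHull_nhdsWithin (hD : D.IsLinearCoxeterSystem) {v : V}
    (hv : v ∈ D.titsCone) : ∃ a ∈ convexHull ℝ (D.orbit v),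
      D.titsCone ∈ 𝓝[(Submodule.span ℝ (D.orbit v))] a := by
  classical
  have horb : D.orbit v ⊆ D.titsCone := by
    rintro _ ⟨w, hw, rfl⟩
    exact D.apply_mem_titsCone hw hv
  obtain ⟨b, φ, hfin, hbt, -, hφ, hexp⟩ := exists_dual_family (s := (∅ : Set V))
    (linearIndepOn_empty ℝ id) (empty_subset (D.orbit v))
  have := hfin.fintype
  set U := Submodule.span ℝ (D.orbit v)
  have hvU : v ∈ U := Submodule.subset_span (self_mem_orbit v)
  let m : ℝ := Fintype.card b + 1
  have hm : 0 < m := by positivity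
  let q : V := v + ∑ i : b, (i : V)
  refine ⟨m⁻¹ • q, ?_, ?_⟩
  · let z : Option b → V := fun o => o.elim v (↑)
    have h := (convex_convexHull ℝ (D.orbit v)).sum_mem (t := Finset.univ)
      (w := fun _ : Option b => m⁻¹) (z := z) (fun _ _ => (inv_pos.2 hm).le)
      (by
        rw [Finset.sum_const, Finset.card_univ, Fintype.card_option, nsmul_eq_mul, Nat.cast_succ]
        exact mul_inv_cancel₀ hm.ne') (by
        rintro (_ | i) _
        · exact subset_convexHull ℝ _ (self_mem_orbit v)
        · exact subset_convexHull ℝ _ (hbt i.2))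
    rw [← Finset.smul_sum, Fintype.sum_option] at h
    exact h
  · have hpos : ∀ᶠ p in 𝓝 q, ∀ i : b, 0 < φ i (p - v) := by
      rw [eventually_all]
      intro i
      have hc : Continuous fun p => φ i (p - v) :=
        (φ i).continuous_of_finiteDimensional.comp (by fun_prop)
      refine hc.continuousAt.eventually (lt_mem_nhds ?_)
      simp [q, map_sum, hφ]
    have hT : D.titsCone ∈ 𝓝[U] q := by
      filter_upwards [nhdsWithin_le_nhds hpos, self_mem_nhdsWithin] with p hp hpU
      have h := hexp (p - v) (U.sub_mem hpU hvU)
      rw [sub_eq_iff_eq_add'] at h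
      rw [h]
      refine hD.add_mem_titsCone hv ?_
      refine Finset.sum_induction _ (· ∈ D.titsCone) (fun _ _ => hD.add_mem_titsCone)
        ⟨1, one_mem _, 0, fun s => by simp, by simp⟩ fun i _ => ?_
      exact D.smul_mem_titsCone (horb (hbt i.2)) (hp i).le
    have hscale : Tendsto (fun p : V => m • p) (𝓝[U] (m⁻¹ • q)) (𝓝[U] q) := by
      refine tendsto_nhdsWithin_iff.2 ⟨?_, ?_⟩
      · have := (continuous_const_smul m).tendsto (m⁻¹ • q)
        rw [smul_inv_smul₀ hm.ne'] at this
        exact this.mono_left nhdsWithin_le_nhds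
      · filter_upwards [self_mem_nhdsWithin] with p hp using U.smul_mem _ hp
    filter_upwards [hscale hT] with p hp
    have := D.smul_mem_titsCone (x := m • p) hp (inv_pos.2 hm).le
    rwa [inv_smul_smul₀ hm.ne'] at this

/-- A point `x` of the Tits cone whose orbit lies in `v - C̄_v` belongs to the closed convex hull of
the orbit of `v`. -/
theorem mem_closedConvexHull_of_forall (hD : D.IsLinearCoxeterSystem) {v : V}
    (hv : v ∈ D.titsCone) {x : V} (hx : x ∈ D.titsCone)
    (h : ∀ w ∈ D.weylGroup, v - w x ∈ closure (D.coneAt v : Set V)) :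
    x ∈ closedConvexHull ℝ (D.orbit v) := by
  obtain ⟨g, hg, k, hk, rfl⟩ := hv
  rw [orbit_apply hg]
  have hk' : ∀ w ∈ D.weylGroup, k - w x ∈ closure (D.coneAt k : Set V) := by
    intro w hw
    have := apply_mem_closure_coneAt (inv_mem hg) (h _ (mul_mem hg hw))
    rwa [map_sub, LinearEquiv.mul_apply, inv_apply_self', inv_apply_self'] at this
  set U := Submodule.span ℝ (D.orbit k) with hUdef
  have horbU : D.orbit k ⊆ U := Submodule.subset_span
  have hU : ∀ w ∈ D.weylGroup, ∀ u ∈ U, w u ∈ U := by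
    intro w hw
    have : U ≤ U.comap (w : V →ₗ[ℝ] V) :=
      Submodule.span_le.2 fun y hy => horbU (apply_mem_orbit hw hy)
    exact this
  have hUcl : IsClosed (U : Set V) := U.closed_of_finiteDimensional
  obtain ⟨a, haA, haT⟩ := hD.exists_mem_convexHull_nhdsWithin (D.chamber_subset_titsCone hk)
  have hkU : k ∈ U := horbU (self_mem_orbit k)
  have hcone : (D.coneAt k : Set V) ⊆ U := by
    have : D.coneAt k ≤ U.restrictScalars _ :=
      coneAt_le fun y hy => U.sub_mem hkU (horbU hy)
    exact this
  have hxU : x ∈ U := by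
    have h1 := closure_minimal hcone hUcl (hk' 1 (one_mem _))
    have h2 := U.sub_mem hkU h1
    rwa [sub_sub_cancel] at h2
  refine hD.mem_of_forall_sub_mem hU isClosed_closedConvexHull convex_closedConvexHull
    (closedConvexHull_min horbU U.convex hUcl) (fun w hw b hb => apply_mem_closedConvexHull hw hb)
    (convexHull_subset_closedConvexHull haA) haT
    (subset_closedConvexHull (self_mem_orbit k)) hxU hx fun w hw => ?_
  exact closure_mono (hD.coneAt_le_coneOn hk horbU) (hk' w hw)

theorem isClosed_coneAt (hD : D.IsLinearCoxeterSystem) {v : V} (hv : v ∈ interior D.titsCone) :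
    IsClosed (D.coneAt v : Set V) := by
  obtain ⟨g, hg, k, hk, rfl⟩ := interior_subset hv
  have hki : k ∈ interior D.titsCone := by
    refine interior_maximal (fun y hy => ?_) (isOpen_interior.preimage (continuous_equiv g)) hv
    have := D.apply_mem_titsCone (inv_mem hg) (interior_subset hy)
    rwa [inv_apply_self'] at this
  have h : (D.coneAt (g k) : Set V) = (g⁻¹ : V ≃ₗ[ℝ] V) ⁻¹' (D.coneAt k : Set V) := by
    ext c
    rw [mem_preimage, SetLike.mem_coe, SetLike.mem_coe, ← apply_mem_coneAt_iff hg (v := k),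
      apply_inv_self']
  rw [h]
  exact (hD.isClosed_coneAt_of_mem_chamber hk hki).preimage (continuous_equiv _)

theorem isClosed_simpleCone (hD : D.IsLinearCoxeterSystem) : IsClosed (D.simpleCone : Set V) := by
  have := hD.finite_index
  exact isClosed_hull_of_finite (finite_range _)

end IsLinearCoxeterSystem

end Hull

end ReflectionData

open ReflectionData

theorem theorem2p13 {S V : Type*} [AddCommGroup V] [Module ℝ V] [FiniteDimensional ℝ V]
    [TopologicalSpace V] [IsTopologicalAddGroup V] [ContinuousSMul ℝ V] [T2Space V]
    (D : ReflectionData S V) (hD : D.IsLinearCoxeterSystem)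
    (v : V) (hv : v ∈ D.titsCone) :
    closedConvexHull ℝ (D.orbit v) ∩ D.titsCone =
        D.titsCone ∩ ⋂ w ∈ D.weylGroup, (fun c => w (v - c)) '' closure (D.coneAt v : Set V) ∧
    (v ∈ interior D.titsCone →
      IsClosed (D.coneAt v : Set V) ∧
      closedConvexHull ℝ (D.orbit v) ⊆ interior D.titsCone ∧
      closedConvexHull ℝ (D.orbit v) =
        D.titsCone ∩ ⋂ w ∈ D.weylGroup, (fun c => w (v - c)) '' (D.coneAt v : Set V) ∧
      ∀ v' ∈ D.orbit v ∩ D.chamber,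
        closedConvexHull ℝ (D.orbit v) =
          D.titsCone ∩ ⋂ w ∈ D.weylGroup,
            (fun c => w (v' - c)) '' (D.simpleCone : Set V)) := by
  have hmain : closedConvexHull ℝ (D.orbit v) ∩ D.titsCone =
      D.titsCone ∩ ⋂ w ∈ D.weylGroup,
        (fun c => w (v - c)) '' closure (D.coneAt v : Set V) := by
    ext x
    rw [mem_inter_iff, mem_inter_iff, and_comm, mem_iInter_image_iff]
    refine and_congr_right fun hx => ⟨fun h w hw => ?_, hD.mem_closedConvexHull_of_forall hv hx⟩
    exact hD.sub_mem_closure_coneAt hv (apply_mem_closedConvexHull hw h)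
  refine ⟨hmain, fun hvi => ?_⟩
  have hcl := hD.isClosed_coneAt hvi
  have hsub := hD.closedConvexHull_orbit_subset_interior hvi
  have hsubT := hsub.trans interior_subset
  refine ⟨hcl, hsub, ?_, ?_⟩
  · rw [hcl.closure_eq, inter_eq_left.2 hsubT] at hmain
    exact hmain
  · rintro v' ⟨hv'o, hv'K⟩
    have horb : D.orbit v' = D.orbit v := by
      obtain ⟨g, hg, rfl⟩ := hv'o
      exact orbit_apply hg v
    have hv'A : v' ∈ closedConvexHull ℝ (D.orbit v) := subset_closedConvexHull hv'o
    have hle : D.coneAt v' ≤ D.simpleCone := by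
      rw [← coneOn_top]
      exact hD.coneAt_le_coneOn hv'K fun _ _ => trivial
    ext x
    rw [mem_inter_iff, mem_iInter_image_iff]
    constructor
    · refine fun hx => ⟨hsubT hx, fun w hw => ?_⟩
      have h := apply_mem_closedConvexHull hw hx
      rw [← horb] at h
      have h2 := hD.sub_mem_closure_coneAt (D.chamber_subset_titsCone hv'K) h
      exact closure_minimal hle hD.isClosed_simpleCone h2
    · rintro ⟨hxT, hx⟩
      refine hD.mem_of_forall_sub_mem (U := ⊤) (fun _ _ _ _ => trivial)
        isClosed_closedConvexHull convex_closedConvexHull (fun _ _ => trivial)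
        (fun w hw b hb => apply_mem_closedConvexHull hw hb)
        (subset_closedConvexHull (self_mem_orbit v))
        (nhdsWithin_le_nhds (mem_interior_iff_mem_nhds.1 hvi)) hv'A trivial hxT fun w hw => ?_
      rw [coneOn_top]
      exact subset_closure (hx w hw)
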